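/- **Definitions.** For a finite set $A$ of vectors in a lattice $\Lambda$ in a real vector space, the arithmetic Tutte polynomial is $$M_A(x,y)=\sum_{B\subseteq A} m(B)\,(x-1)^{r(A)-r(B)}(y-1)^{|B|-r(B)},$$ where $r(B)=\dim\operatorname{span}B$ and $m(B)$ is the index of $\mathbb ZB$ in $\operatorname{span}B\cap\Lambda$. The arithmetic coboundary polynomial is $\psi_A(X,Y)=(y-1)^{r(A)}M_A(x,y)$ with $x=\frac{X+Y-1}{Y-1}$, $y=Y$. Consider the (positive) root systems $$A_{n-1}=\{e_i-e_j: i<j\},\qquad D_n=\{e_i-e_j,\ e_i+e_j: i<j\},$$ $$B_n=D_n\cup\{e_i\},\qquad C_n=D_n\cup\{2e_i\},$$ where $1\le i,j\le n$, and their weight lattices $$\Lambda_W(A_{n-1})=\mathbb Z\{e_1,\dots,e_n\}/(\textstyle\sum e_i=0),\qquad \Lambda_W(C_n)=\mathbb Z\{e_1,\dots,e_n\},$$ $$\Lambda_W(B_n)=\Lambda_W(D_n)=\mathbb Z\{e_1,\dots,e_n,\tfrac12(e_1+\cdots+e_n)\}.$$ (For type $A$, the roots $e_i-e_j$ are taken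 in the quotient $\mathbb R^n/(\sum e_i=0)$.) Let $\psi^W_{\Phi}$ be the arithmetic coboundary polynomial of $\Phi$ in its weight lattice, and put $$\Psi^W_A=1+X\sum_{n\ge1}\psi^W_{A_{n-1}}(X,Y)\frac{Z^n}{n!},\qquad \Psi^W_\Phi=\sum_{n\ge0}\psi^W_{\Phi_n}(X,Y)\frac{Z^n}{n!}\quad(\Phi=B,C,D).$$ Let $\Psi_C$ be the series defined as $\Psi^W_C$, but with respect to the integer lattices $\mathbb Z^n$. Let $F(\alpha,\beta)=\sum_{n\ge0}\alpha^n\beta^{\binom n2}/n!$. Powers $S^c$ of formal power series $S$ in $Z$ with constant term $1$ are given by the binomial series $S^c=\sum_{k\ge0}\binom ck(S-1)^k$. **Theorem.** For each $n\ge1$ let $\omega_n\in\mathbb C$ be a primitive $n$th root of unity and let $\varphi$ be Euler's totient function. Then, as formal power series, $$\Psi^W_A=1+\sum_{n\ge1}\varphi(n)\left(\left[\prod_{k=0}^{n-1}F(\omega_n^kZ,Y)\right]^{X/n}-1\right),$$ where only finitely many terms of the sum contribute to the coefficient of any given power of $Z$; $$1+\Psi^W_B=F(2Z,Y)^{\frac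 X4-1}F(Z,Y^2)F(YZ,Y^2)\left[F(2Z,Y)^{\frac X4}+F(-2Z,Y)^{\frac X4}\right],$$ $$\Psi^W_C=\Psi_C=F(2Z,Y)^{\frac X2-1}F(YZ,Y^2)^2,$$ $$1+(X-1)Z+\Psi^W_D=F(2Z,Y)^{\frac X4-1}F(Z,Y^2)^2\left[F(2Z,Y)^{\frac X4}+F(-2Z,Y)^{\frac X4}\right].$$ In particular, for types $B$ and $D$ the coefficients of $Z^n$ on the right-hand sides are $\psi^W_{B_n}/n!$ for all $n\ge1$ and $\psi^W_{D_n}/n!$ for all $n\ge2$. -/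

import Mathlib

namespace ArithmeticTutte

open Submodule

section Configurations

variable {V : Type*} [AddCommGroup V] [Module ℝ V]

/-- The rank of a finite set of vectors: the dimension of its real span. -/
noncomputable def rank (B : Finset V) : ℕ :=
  Module.finrank ℝ (span ℝ (B : Set V))

/-- The multiplicity `m(B)`: the index of `ℤB` as a sublattice of `span B ∩ Λ`. -/
noncomputable def multiplicity (Λ : Submodule ℤ V) (B : Finset V) : ℕ :=
  (span ℤ (B : Set V)).toAddSubgroup.relIndex
    ((span ℝ (B : Set V)).restrictScalars ℤ ⊓ Λ).toAddSubgroup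

/-- The arithmetic Tutte polynomial `M_A(x,y)` of a finite set `A` of vectors in the lattice `Λ`;
the variables `x`, `y` are `MvPolynomial.X 0`, `MvPolynomial.X 1`. -/
noncomputable def arithmeticTutte (Λ : Submodule ℤ V) (A : Finset V) : MvPolynomial (Fin 2) ℤ :=
  ∑ B ∈ A.powerset, (multiplicity Λ B : MvPolynomial (Fin 2) ℤ) *
    (MvPolynomial.X 0 - 1) ^ (rank A - rank B) * (MvPolynomial.X 1 - 1) ^ (B.card - rank B)

/-- The field `ℂ(X, Y)` of rational functions, over which we take formal power series in `Z`. -/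
abbrev RatXY : Type := FractionRing (MvPolynomial (Fin 2) ℂ)

/-- The indeterminate `X`. -/
noncomputable def varX : RatXY := algebraMap (MvPolynomial (Fin 2) ℂ) RatXY (MvPolynomial.X 0)

/-- The indeterminate `Y`. -/
noncomputable def varY : RatXY := algebraMap (MvPolynomial (Fin 2) ℂ) RatXY (MvPolynomial.X 1)

/-- The arithmetic coboundary polynomial `ψ_A(X,Y) = (y-1)^{r(A)} M_A(x,y)` where
`x = (X+Y-1)/(Y-1)` and `y = Y`. -/
noncomputable def coboundary (Λ : Submodule ℤ V) (A : Finset V) : RatXY :=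
  (varY - 1) ^ rank A *
    MvPolynomial.aeval ![(varX + varY - 1) / (varY - 1), varY] (arithmeticTutte Λ A)

end Configurations

section RootSystems

/-- The standard basis vector `e_i` of `ℝⁿ`. -/
def e {n : ℕ} (i : Fin n) : Fin n → ℝ := Pi.single i 1

/-- The pairs `(i, j)` with `i < j`. -/
def pairs (n : ℕ) : Finset (Fin n × Fin n) := Finset.univ.filter fun p => p.1 < p.2

/-- The space `ℝⁿ / (e_1 + ⋯ + e_n = 0)`. -/
abbrev SpaceA (n : ℕ) : Type := (Fin n → ℝ) ⧸ span ℝ {(∑ i, e i : Fin n → ℝ)}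

/-- The class of `e_i` in `ℝⁿ / (e_1 + ⋯ + e_n = 0)`. -/
def eA {n : ℕ} (i : Fin n) : SpaceA n := Submodule.Quotient.mk (e i)

open Classical in
/-- The positive roots `e_i - e_j` (`i < j`) of `A_{n-1}`, in `ℝⁿ / (e_1 + ⋯ + e_n = 0)`. -/
noncomputable def rootsA (n : ℕ) : Finset (SpaceA n) :=
  (pairs n).image fun p => eA p.1 - eA p.2

open Classical in
/-- The positive roots `e_i - e_j`, `e_i + e_j` (`i < j`) of `D_n`. -/
noncomputable def rootsD (n : ℕ) : Finset (Fin n → ℝ) :=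
  ((pairs n).image fun p => e p.1 - e p.2) ∪ ((pairs n).image fun p => e p.1 + e p.2)

open Classical in
/-- The positive roots `e_i - e_j`, `e_i + e_j` (`i < j`) and `e_i` of `B_n`. -/
noncomputable def rootsB (n : ℕ) : Finset (Fin n → ℝ) :=
  rootsD n ∪ Finset.univ.image fun i => e i

open Classical in
/-- The positive roots `e_i - e_j`, `e_i + e_j` (`i < j`) and `2e_i` of `C_n`. -/
noncomputable def rootsC (n : ℕ) : Finset (Fin n → ℝ) :=
  rootsD n ∪ Finset.univ.image fun i => (2 : ℝ) • e i

/-- The integer lattice `ℤ{e_1, …, e_n}`. -/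
def integerLattice (n : ℕ) : Submodule ℤ (Fin n → ℝ) :=
  span ℤ (Set.range e)

/-- The weight lattice `ℤ{e_1, …, e_n} / (e_1 + ⋯ + e_n = 0)` of `A_{n-1}`. -/
def weightLatticeA (n : ℕ) : Submodule ℤ (SpaceA n) :=
  span ℤ (Set.range eA)

/-- The weight lattice `ℤ{e_1, …, e_n, (e_1 + ⋯ + e_n)/2}` of `B_n`. -/
noncomputable def weightLatticeB (n : ℕ) : Submodule ℤ (Fin n → ℝ) :=
  span ℤ (Set.range e ∪ {(1 / 2 : ℝ) • ∑ i, e i})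

/-- The weight lattice `ℤ{e_1, …, e_n}` of `C_n`. -/
def weightLatticeC (n : ℕ) : Submodule ℤ (Fin n → ℝ) :=
  span ℤ (Set.range e)

/-- The weight lattice `ℤ{e_1, …, e_n, (e_1 + ⋯ + e_n)/2}` of `D_n`. -/
noncomputable def weightLatticeD (n : ℕ) : Submodule ℤ (Fin n → ℝ) :=
  span ℤ (Set.range e ∪ {(1 / 2 : ℝ) • ∑ i, e i})

end RootSystems

section Series

open PowerSeries

/-- The exponential generating function `∑_{n ≥ 0} a_n Z^n / n!`. -/
noncomputable def egf (a : ℕ → RatXY) : PowerSeries RatXY :=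
  mk fun n => a n / (n.factorial : RatXY)

/-- `Ψ^W_A = 1 + X ∑_{n ≥ 1} ψ^W_{A_{n-1}}(X,Y) Z^n / n!`. -/
noncomputable def PsiWA : PowerSeries RatXY :=
  egf fun n => if n = 0 then 1 else varX * coboundary (weightLatticeA n) (rootsA n)

/-- `Ψ^W_B = ∑_{n ≥ 0} ψ^W_{B_n}(X,Y) Z^n / n!`. -/
noncomputable def PsiWB : PowerSeries RatXY :=
  egf fun n => coboundary (weightLatticeB n) (rootsB n)

/-- `Ψ^W_C = ∑_{n ≥ 0} ψ^W_{C_n}(X,Y) Z^n / n!`. -/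
noncomputable def PsiWC : PowerSeries RatXY :=
  egf fun n => coboundary (weightLatticeC n) (rootsC n)

/-- `Ψ^W_D = ∑_{n ≥ 0} ψ^W_{D_n}(X,Y) Z^n / n!`. -/
noncomputable def PsiWD : PowerSeries RatXY :=
  egf fun n => coboundary (weightLatticeD n) (rootsD n)

/-- `Ψ_C = ∑_{n ≥ 0} ψ_{C_n}(X,Y) Z^n / n!`, with respect to the integer lattices. -/
noncomputable def PsiC : PowerSeries RatXY :=
  egf fun n => coboundary (integerLattice n) (rootsC n)

/-- The deformed exponential function
`F(αZ, β) = ∑_{n ≥ 0} (αZ)^n β^(n choose 2) / n!`, as a formal power series in `Z`. -/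
noncomputable def F (α β : RatXY) : PowerSeries RatXY :=
  mk fun n => α ^ n * β ^ (n.choose 2) / (n.factorial : RatXY)

/-- The power `S^c = ∑_{k ≥ 0} (c choose k) (S - 1)^k` of a formal power series `S` with
constant term `1`, with exponent `c` in the coefficient field. -/
noncomputable def power (S : PowerSeries RatXY) (c : RatXY) : PowerSeries RatXY :=
  (PowerSeries.binomialSeries RatXY c).subst (S - 1)

/-- The family `f` of formal power series in `Z` has the formal sum `g`: for each `N`, only
finitely many members have a nonzero coefficient of `Z^N`, and these coefficients add up to the
coefficient of `Z^N` in `g`. -/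
def HasFormalSum {ι : Type*} (f : ι → PowerSeries RatXY) (g : PowerSeries RatXY) : Prop :=
  ∀ N : ℕ, (Function.support fun i => coeff N (f i)).Finite ∧
    ∑ᶠ i, coeff N (f i) = coeff N g

end Series

end ArithmeticTutte

/-!
For a natural number `q` divisible by a suitable `d` depending on `A`, the finite field method holds
on the torus `Hom(Λ, ℤ/q)`: weighting each point by `Y` to the number of subtori `{v = 0}`, `v ∈ A`,
that contain it, the total weight is `q ^ (rk Λ - r(A))` times the value of the coboundary
polynomial at `X = q`.

For the four root systems the points of the torus are colourings of `{1, …, n}` by elements of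
`ℤ/q`, or of `ℤ/2N` up to signs, and the weight is a product over colour classes. So the exponential
generating function of the total weights is a product of deformed exponential functions, one for
each colour. The half-sum in the lattices of types `B` and `D` is taken into account by the parity
character of `ℤ/2N`, and the relation `∑ e_i = 0` in type `A` by all characters of `ℤ/q`, grouped by
their orders; this gives a sum of powers with exponent proportional to `q`. The coefficients of such
powers are polynomials in the exponent, hence the identity for all multiples `q` of some `d` is an
identity of polynomials in `X`.
-/

namespace ArithmeticTutte


section Colourings

open Finset

theorem card_filter_product_lt {ι : Type*} [LinearOrder ι] (s : Finset ι) :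
    #{p ∈ s ×ˢ s | p.1 < p.2} = (#s).choose 2 := by
  have hlt : #{p ∈ s.offDiag | p.1 < p.2} = #{p ∈ s ×ˢ s | p.1 < p.2} :=
    congrArg card <| by grind
  have hgt : #{p ∈ s.offDiag | ¬p.1 < p.2} = #{p ∈ s ×ˢ s | p.1 < p.2} :=
    card_equiv (Equiv.prodComm ι ι) fun p => by
      simp only [mem_filter, mem_offDiag, mem_product, Equiv.prodComm_apply, Prod.fst_swap,
        Prod.snd_swap]
      grind
  have hcard := card_filter_add_card_filter_not (s := s.offDiag) fun p : ι × ι => p.1 < p.2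
  rw [hlt, hgt, offDiag_card, ← Nat.mul_sub_one] at hcard
  rw [Nat.choose_two_right]
  omega

theorem prod_pairs_ite_eq {M B : Type*} [CommMonoid M] [Fintype B] [DecidableEq B] {n : ℕ}
    (g : B → M) (c : Fin n → B) :
    ∏ p ∈ pairs n, (if c p.1 = c p.2 then g (c p.1) else 1) =
      ∏ b, g b ^ (#{i | c i = b}).choose 2 := by
  have hpow (b : B) : g b ^ (#{i | c i = b}).choose 2 =
      ∏ p ∈ pairs n, if c p.1 = b ∧ c p.2 = b then g b else 1 := by
    rw [← card_filter_product_lt, ← prod_const, ← prod_filter]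
    exact prod_congr (by grind [pairs]) fun _ _ => rfl
  simp_rw [hpow]
  rw [prod_comm]
  refine prod_congr rfl fun p _ => ?_
  rw [prod_eq_single (c p.1) (fun b _ hb => if_neg fun h => hb h.1.symm) (by simp)]
  simp [eq_comm]

theorem sum_card_fiber {R B : Type*} [CommRing R] [Fintype B] [DecidableEq B] (n : ℕ)
    (w : (B → ℕ) → R) :
    ∑ c : Fin n → B, w (fun b => #{i | c i = b}) =
      ∑ l ∈ (univ : Finset B).piAntidiag n, (Nat.multinomial univ l : R) * w l := by
  -- Apply the linear functional sending the monomial `X ^ l` to `w l` to `(∑ b, X b) ^ n`.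
  let L : MvPolynomial B R →ₗ[R] R := (MvPolynomial.basisMonomials B R).constr R fun l => w l
  have hL (l : B → ℕ) : L (∏ b, MvPolynomial.X b ^ l b) = w l := by
    have hmonomial : (∏ b, MvPolynomial.X b ^ l b : MvPolynomial B R) =
        MvPolynomial.basisMonomials B R (Finsupp.equivFunOnFinite.symm l) := by
      simp [MvPolynomial.monomial_eq, Finsupp.prod_fintype]
    rw [hmonomial]
    exact (MvPolynomial.basisMonomials B R).constr_basis R _ _
  have hfiber (c : Fin n → B) : ∏ i, (MvPolynomial.X (c i) : MvPolynomial B R) =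
      ∏ b, MvPolynomial.X b ^ #{i | c i = b} := by
    rw [← Finset.prod_fiberwise univ c]
    exact prod_congr rfl fun b _ => prod_eq_pow_card fun i hi => by rw [(mem_filter.1 hi).2]
  have hpow := Finset.sum_pow' univ (fun b : B => (MvPolynomial.X b : MvPolynomial B R)) n
  rw [Finset.sum_pow_eq_sum_piAntidiag, Fintype.piFinset_univ] at hpow
  have hLpow := congrArg L hpow
  simp_rw [← nsmul_eq_mul, map_sum, map_nsmul, hfiber, hL, nsmul_eq_mul] at hLpow
  exact hLpow.symm

theorem sum_prod_card_fiber {K B : Type*} [Field K] [CharZero K] [Fintype B] [DecidableEq B]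
    (n : ℕ) (w : B → ℕ → K) :
    ∑ c : Fin n → B, ∏ b, w b #{i | c i = b} =
      n.factorial * PowerSeries.coeff n
        (∏ b, PowerSeries.mk fun k => w b k / (k.factorial : K)) := by
  rw [sum_card_fiber n fun l => ∏ b, w b (l b), PowerSeries.coeff_prod, mul_sum]
  refine sum_bij' (fun l _ => Finsupp.equivFunOnFinite.symm l) (fun l _ => ⇑l)
    (fun l hl => by simpa [mem_finsuppAntidiag] using hl)
    (fun l hl => by simpa [mem_finsuppAntidiag] using hl)
    (fun _ _ => rfl) (fun _ _ => by ext; rfl) fun l hl => ?_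
  have hsum : ∑ b, l b = n := by simpa using hl
  have hne : (∏ b, ((l b).factorial : K)) ≠ 0 :=
    prod_ne_zero_iff.2 fun b _ => Nat.cast_ne_zero.2 (Nat.factorial_ne_zero _)
  simp only [PowerSeries.coeff_mk, Finsupp.equivFunOnFinite_symm_apply_apply]
  rw [prod_div_distrib, ← hsum, ← Nat.multinomial_spec univ l]
  push_cast
  field_simp

/-- The deformed exponential series `∑ₙ αⁿ β^(n choose 2) Zⁿ / n!` over an arbitrary field; the
series `F` of the theorem is the case of the field `RatXY`. -/
noncomputable def deformedExp {K : Type*} [Field K] (α β : K) : PowerSeries K :=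
  PowerSeries.mk fun n => α ^ n * β ^ (n.choose 2) / (n.factorial : K)

theorem sum_colourings {K B : Type*} [Field K] [CharZero K] [Fintype B] [DecidableEq B] (n : ℕ)
    (g h : B → K) :
    ∑ c : Fin n → B, (∏ p ∈ pairs n, (if c p.1 = c p.2 then g (c p.1) else 1)) * ∏ i, h (c i) =
      n.factorial * PowerSeries.coeff n (∏ b, deformedExp (h b) (g b)) := by
  have hcolour (c : Fin n → B) : (∏ p ∈ pairs n, (if c p.1 = c p.2 then g (c p.1) else 1)) *
      ∏ i, h (c i) = ∏ b, h b ^ #{i | c i = b} * g b ^ (#{i | c i = b}).choose 2 := by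
    rw [prod_pairs_ite_eq, ← Finset.prod_fiberwise univ c, ← prod_mul_distrib]
    refine prod_congr rfl fun b _ => ?_
    rw [mul_comm, prod_eq_pow_card fun i hi => by rw [(mem_filter.1 hi).2]]
  simp_rw [hcolour]
  exact sum_prod_card_fiber n fun b k => h b ^ k * g b ^ k.choose 2

theorem sum_comp_eq_sum_card_fiber {R G B : Type*} [CommSemiring R] [Fintype G] [Fintype B]
    [DecidableEq B] {n : ℕ} (π : G → B) (w : (Fin n → B) → R) :
    ∑ x : Fin n → G, w (π ∘ x) = ∑ c : Fin n → B, w c * ∏ i, (#{a | π a = c i} : R) := by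
  classical
  rw [← Finset.sum_fiberwise univ (fun x : Fin n → G => π ∘ x)]
  refine sum_congr rfl fun c _ => ?_
  rw [sum_congr rfl (g := fun _ => w c) fun x hx => by rw [(mem_filter.1 hx).2], sum_const,
    nsmul_eq_mul, mul_comm, ← Nat.cast_prod, ← Fintype.card_piFinset]
  congr 3
  ext x
  simp [funext_iff]

end Colourings

section BinomialPowers

open PowerSeries

variable {R : Type*} [CommRing R] [BinomialRing R] {S : PowerSeries R}

/-- The power `S ^ c = ∑ₖ (c choose k) (S - 1) ^ k` of a series with constant term `1` over an
arbitrary binomial ring; `power` is the case of the field `RatXY`. -/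
noncomputable def binomialPower (S : PowerSeries R) (c : R) : PowerSeries R :=
  (binomialSeries R c).subst (S - 1)

theorem coeff_binomialPower (hS : constantCoeff S = 1) (c : R) (n : ℕ) :
    coeff n (binomialPower S c) =
      ∑ k ∈ Finset.range (n + 1), Ring.choose c k * coeff n ((S - 1) ^ k) := by
  have h0 : constantCoeff (S - 1) = 0 := by simp [hS]
  rw [binomialPower, coeff_subst' (HasSubst.of_constantCoeff_zero' h0),
    finsum_eq_sum_of_support_subset (s := Finset.range (n + 1))]
  · simp [binomialSeries_coeff]
  · refine Function.support_subset_iff'.2 fun k hk => ?_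
    have hnk : (n : ℕ∞) < k := by exact_mod_cast (by simpa using hk : n < k)
    rw [coeff_of_lt_order _ (hnk.trans_le (le_order_pow_of_constantCoeff_eq_zero k h0)), smul_zero]

theorem constantCoeff_binomialPower (hS : constantCoeff S = 1) (c : R) :
    constantCoeff (binomialPower S c) = 1 := by
  simpa using coeff_binomialPower hS c 0

theorem binomialPower_natCast (hS : constantCoeff S = 1) (m : ℕ) :
    binomialPower S (m : R) = S ^ m := by
  have h0 : HasSubst (S - 1) := HasSubst.of_constantCoeff_zero' (by simp [hS])
  rw [binomialPower, binomialSeries_nat, subst_pow h0, subst_add h0, subst_X h0,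
    ← coe_substAlgHom h0, map_one, add_sub_cancel]

theorem coeff_binomialPower_of_lt {d n : ℕ} (hS : X ^ d ∣ S - 1) (c : R) (hn : n < d) :
    coeff n (binomialPower S c) = coeff n (1 : PowerSeries R) := by
  have h0 : constantCoeff S = 1 := by
    simpa [sub_eq_zero] using X_pow_dvd_iff.1 hS 0 (Nat.zero_lt_of_lt hn)
  rw [coeff_binomialPower h0, Finset.sum_range_succ', Finset.sum_eq_zero, zero_add]
  · simp
  · intro k _
    rw [X_pow_dvd_iff.1 (hS.trans (dvd_pow_self _ k.succ_ne_zero)) n hn, mul_zero]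

end BinomialPowers

section PolynomialFamilies

open PowerSeries

/-- A family of power series, indexed by elements `c` of the coefficient ring, each coefficient of
which is a polynomial in `c`. Such a family is determined by its members at infinitely many
integers, see `eval_eq_of_dvd`. -/
def IsPolynomialFamily {R : Type*} [CommRing R] (f : R → PowerSeries R) : Prop :=
  ∀ n, ∃ P : Polynomial R, ∀ c, coeff n (f c) = P.eval c

namespace IsPolynomialFamily

variable {R : Type*} [CommRing R] {f g : R → PowerSeries R}

theorem const (S : PowerSeries R) : IsPolynomialFamily fun _ => S :=
  fun n => ⟨Polynomial.C (coeff n S), fun c => by simp⟩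

theorem add (hf : IsPolynomialFamily f) (hg : IsPolynomialFamily g) :
    IsPolynomialFamily fun c => f c + g c := fun n => by
  obtain ⟨P, hP⟩ := hf n
  obtain ⟨Q, hQ⟩ := hg n
  exact ⟨P + Q, fun c => by simp [hP, hQ]⟩

theorem mul (hf : IsPolynomialFamily f) (hg : IsPolynomialFamily g) :
    IsPolynomialFamily fun c => f c * g c := fun n => by
  choose P hP using hf
  choose Q hQ using hg
  exact ⟨∑ p ∈ Finset.HasAntidiagonal.antidiagonal n, P p.1 * Q p.2, fun c => by
    simp [coeff_mul, hP, hQ, Polynomial.eval_finsetSum]⟩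

theorem comp (hf : IsPolynomialFamily f) (Q : Polynomial R) :
    IsPolynomialFamily fun c => f (Q.eval c) := fun n => by
  obtain ⟨P, hP⟩ := hf n
  exact ⟨P.comp Q, fun c => by simp [hP]⟩

theorem sum {ι : Type*} (s : Finset ι) {f : ι → R → PowerSeries R}
    (hf : ∀ i ∈ s, IsPolynomialFamily (f i)) : IsPolynomialFamily fun c => ∑ i ∈ s, f i c :=
  fun n => by
    choose! P hP using fun i hi => hf i hi n
    exact ⟨∑ i ∈ s, P i, fun c => by
      rw [map_sum, Polynomial.eval_finsetSum]
      exact Finset.sum_congr rfl fun i hi => hP i hi c⟩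

end IsPolynomialFamily

variable {K : Type*} [Field K] [CharZero K]

theorem eval_eq_of_dvd {P Q : Polynomial K} {d : ℕ} (hd : d ≠ 0)
    (h : ∀ q : ℕ, q ≠ 0 → d ∣ q → P.eval (q : K) = Q.eval (q : K)) (c : K) :
    P.eval c = Q.eval c := by
  have hinj : Function.Injective fun k : ℕ => ((d * (k + 1) : ℕ) : K) := fun a b hab => by
    simpa [hd] using hab
  rw [Polynomial.eq_of_infinite_eval_eq P Q <| (Set.infinite_range_of_injective hinj).mono <|
    Set.range_subset_iff.2 fun k => h _ (by positivity) (dvd_mul_right _ _)]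

-- The `BinomialRing` structure is a parameter because the one found for `RatXY` is not
-- definitionally the one found for a general field of characteristic zero.
variable [BinomialRing K]

theorem ring_choose_eq_eval (c : K) (k : ℕ) :
    Ring.choose c k = (Polynomial.C (k.factorial : K)⁻¹ * descPochhammer K k).eval c := by
  have h := Ring.descPochhammer_eq_factorial_smul_choose c k
  rw [nsmul_eq_mul, ← Polynomial.eval₂_smulOneHom_eq_smeval] at h
  rw [Polynomial.eval_C_mul, eq_inv_mul_iff_mul_eq₀ (Nat.cast_ne_zero.2 k.factorial_ne_zero), ← h,
    ← descPochhammer_map (Int.castRingHom K), Polynomial.eval_map,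
    RingHom.ext_int (Int.castRingHom K)]

theorem isPolynomialFamily_binomialPower {S : PowerSeries K} (hS : constantCoeff S = 1) :
    IsPolynomialFamily (binomialPower S) := fun n =>
  ⟨∑ k ∈ Finset.range (n + 1), Polynomial.C ((k.factorial : K)⁻¹) * descPochhammer K k *
    Polynomial.C (coeff n ((S - 1) ^ k)), fun c => by
    rw [coeff_binomialPower hS, Polynomial.eval_finsetSum]
    exact Finset.sum_congr rfl fun k _ => by
      rw [ring_choose_eq_eval, Polynomial.eval_mul (p := _ * _), Polynomial.eval_C]⟩

theorem isPolynomialFamily_binomialPower_div_sub {S : PowerSeries K} (hS : constantCoeff S = 1)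
    (a b : K) : IsPolynomialFamily fun c => binomialPower S (c / a - b) := by
  convert (isPolynomialFamily_binomialPower hS).comp
    (Polynomial.C a⁻¹ * Polynomial.X - Polynomial.C b) using 3
  simp [div_eq_inv_mul]

theorem isPolynomialFamily_binomialPower_div {S : PowerSeries K} (hS : constantCoeff S = 1)
    (a : K) : IsPolynomialFamily fun c => binomialPower S (c / a) := by
  simpa using isPolynomialFamily_binomialPower_div_sub hS a 0

end PolynomialFamilies

section Lattices

open Submodule Module

theorem relIndex_span_smul {M κ : Type*} [AddCommGroup M] [Fintype κ] {w : κ → M}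
    (hw : LinearIndependent ℤ w) {a : κ → ℤ} (ha : ∀ i, a i ≠ 0) :
    (span ℤ (Set.range fun i => a i • w i)).toAddSubgroup.relIndex
      (span ℤ (Set.range w)).toAddSubgroup = ∏ i, (a i).natAbs := by
  classical
  have haw : LinearIndependent ℤ fun i => a i • w i :=
    Fintype.linearIndependent_iff.2 fun g hg i => by
      have := Fintype.linearIndependent_iff.1 hw (fun i => g i * a i)
        (by simpa only [mul_smul] using hg) i
      exact (mul_eq_zero.1 this).resolve_right (ha i)
  have hle : (span ℤ (Set.range fun i => a i • w i)).toAddSubgroup ≤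
      (span ℤ (Set.range w)).toAddSubgroup :=
    span_le.2 <| Set.range_subset_iff.2 fun i => smul_mem _ _ (subset_span ⟨i, rfl⟩)
  have hdet := (Basis.span hw).det.map_smul_univ a (Basis.span hw)
  rw [Basis.det_self, smul_eq_mul, mul_one] at hdet
  refine (AddSubgroup.relIndex_eq_natAbs_det _ _ hle (Basis.span haw) (Basis.span hw)).trans
    ((congrArg Int.natAbs (Eq.trans (congrArg _ <| funext fun i => Subtype.ext ?_) hdet)).trans
      (map_prod Int.natAbsHom a Finset.univ))
  exact (congrArg Subtype.val (Basis.span_apply haw i)).trans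
    (congrArg (fun v => a i • v.val) (Basis.span_apply hw i)).symm

theorem span_range_coe_basis {M κ : Type*} [AddCommGroup M] {N : Submodule ℤ M}
    (b : Basis κ ℤ N) : span ℤ (Set.range fun i => (b i : M)) = N := by
  have h := congrArg (Submodule.map N.subtype) b.span_eq
  rwa [map_span, ← Set.range_comp, Submodule.map_top, range_subtype] at h

theorem exists_basis_of_span_eq {M κ : Type*} [AddCommGroup M] {N : Submodule ℤ M} {c : κ → M}
    (hc : LinearIndependent ℤ c) (h : span ℤ (Set.range c) = N) :
    ∃ b : Basis κ ℤ N, ∀ i, (b i : M) = c i := by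
  subst h
  exact ⟨Basis.span hc, fun i => congrArg Subtype.val (Basis.span_apply hc i)⟩

theorem exists_adapted_basis {M κ : Type*} [AddCommGroup M] [Finite κ] {N : Submodule ℤ M}
    (b : Basis κ ℤ N) {B : Set M} (hB : B ⊆ N) :
    ∃ (b' : Basis κ ℤ N) (k : ℕ) (f : Fin k ↪ κ) (a : Fin k → ℤ), (∀ i, a i ≠ 0) ∧
      span ℤ B = span ℤ (Set.range fun i => a i • (b' (f i) : M)) := by
  obtain ⟨k, snf⟩ := smithNormalForm b ((span ℤ B).comap N.subtype)
  refine ⟨snf.bM, k, snf.f, snf.a, fun i hi => snf.bN.ne_zero i ?_, ?_⟩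
  · have h := snf.snf i
    rw [hi, zero_smul] at h
    exact_mod_cast h
  · have h := congrArg (Submodule.map N.subtype) (span_range_coe_basis snf.bN)
    rw [map_comap_subtype, inf_eq_right.2 (span_le.2 hB), map_span, ← Set.range_comp] at h
    refine h.symm.trans (congrArg (span ℤ) (congrArg Set.range (funext fun i => ?_)))
    simp [snf.snf]

variable {V : Type*} [AddCommGroup V] [Module ℝ V]

theorem span_real_range_smul {κ : Type*} (w : κ → V) {a : κ → ℤ} (ha : ∀ i, a i ≠ 0) :
    span ℝ (Set.range fun i => a i • w i) = span ℝ (Set.range w) := by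
  refine le_antisymm (span_le.2 <| Set.range_subset_iff.2 fun i => ?_)
    (span_le.2 <| Set.range_subset_iff.2 fun i => ?_)
  · exact zsmul_mem (subset_span (Set.mem_range_self i)) (a i)
  · have hw : w i = (a i : ℝ)⁻¹ • (a i • w i) := by
      rw [← Int.cast_smul_eq_zsmul ℝ, inv_smul_smul₀ (Int.cast_ne_zero.2 (ha i))]
    rw [hw]
    exact smul_mem _ _ (subset_span (Set.mem_range_self i))

theorem span_real_eq_of_span_int_eq {s t : Set V} (h : span ℤ s = span ℤ t) :
    span ℝ s = span ℝ t := by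
  rw [← span_span_of_tower ℤ, h, span_span_of_tower]

variable {Λ : Submodule ℤ V} {ι : Type*}

theorem saturation_eq_span_int {b : Basis ι ℤ Λ} (hb : LinearIndependent ℝ fun i => (b i : V))
    (s : Set ι) :
    (span ℝ ((fun i => (b i : V)) '' s)).restrictScalars ℤ ⊓ Λ =
      span ℤ ((fun i => (b i : V)) '' s) := by
  refine le_antisymm ?_ (le_inf (span_le_restrictScalars ℤ ℝ _) (span_le.2 ?_))
  · rintro v ⟨hreal, hint⟩
    obtain ⟨l, hl, hlv⟩ := (Finsupp.mem_span_image_iff_linearCombination ℝ).1 hreal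
    have hz : Finsupp.linearCombination ℤ (fun i => (b i : V)) (b.repr ⟨v, hint⟩) = v := by
      have h := congrArg Λ.subtype (b.linearCombination_repr ⟨v, hint⟩)
      rwa [Finsupp.apply_linearCombination] at h
    have hcoord : l = (b.repr ⟨v, hint⟩).mapRange (Int.cast : ℤ → ℝ) Int.cast_zero := by
      refine hb (hlv.trans (hz.symm.trans ?_))
      simp [Finsupp.linearCombination_apply, Finsupp.sum_mapRange_index, Int.cast_smul_eq_zsmul]
    refine (Finsupp.mem_span_image_iff_linearCombination ℤ).2 ⟨_, ?_, hz⟩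
    rw [Finsupp.mem_supported'] at hl ⊢
    intro i hi
    simpa [hcoord] using hl i hi
  · rintro _ ⟨i, _, rfl⟩
    exact (b i).2

theorem linearIndependent_coe_basis [Finite ι] {b : Basis ι ℤ Λ}
    (hb : LinearIndependent ℝ fun i => (b i : V)) (b' : Basis ι ℤ Λ) :
    LinearIndependent ℝ fun i => (b' i : V) := by
  have := Fintype.ofFinite ι
  rw [linearIndependent_iff_card_eq_finrank_span, Set.finrank] at hb ⊢
  rwa [span_real_eq_of_span_int_eq
    ((span_range_coe_basis b').trans (span_range_coe_basis b).symm)]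

variable {b : Basis ι ℤ Λ} {B : Finset V} {k : ℕ} {f : Fin k ↪ ι} {a : Fin k → ℤ}

theorem span_real_eq_of_adapted (ha : ∀ i, a i ≠ 0)
    (hB : span ℤ (B : Set V) = span ℤ (Set.range fun i => a i • (b (f i) : V))) :
    span ℝ (B : Set V) = span ℝ (Set.range fun i => (b (f i) : V)) := by
  rw [span_real_eq_of_span_int_eq hB, span_real_range_smul _ ha]

theorem rank_eq_of_adapted (hb : LinearIndependent ℝ fun i => (b i : V)) (ha : ∀ i, a i ≠ 0)
    (hB : span ℤ (B : Set V) = span ℤ (Set.range fun i => a i • (b (f i) : V))) :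
    rank B = k := by
  rw [rank, span_real_eq_of_adapted ha hB]
  exact (finrank_span_eq_card (hb.comp f f.injective)).trans (Fintype.card_fin k)

theorem multiplicity_eq_of_adapted (hb : LinearIndependent ℝ fun i => (b i : V))
    (ha : ∀ i, a i ≠ 0)
    (hB : span ℤ (B : Set V) = span ℤ (Set.range fun i => a i • (b (f i) : V))) :
    multiplicity Λ B = ∏ i, (a i).natAbs := by
  have hrange : Set.range (fun i => (b (f i) : V)) = (fun i => (b i : V)) '' Set.range f :=
    Set.range_comp (fun i => (b i : V)) f
  rw [multiplicity, span_real_eq_of_adapted ha hB, hrange, saturation_eq_span_int hb, ← hrange, hB]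
  exact relIndex_span_smul ((hb.comp f f.injective).restrict_scalars' ℤ) ha

end Lattices

section TorusCounting

open Submodule Module

theorem card_zmod_smul_eq_zero {q : ℕ} [NeZero q] {a : ℤ} (h : a.natAbs ∣ q) :
    Nat.card {y : ZMod q // a • y = 0} = a.natAbs := by
  have hker := IsAddCyclic.card_nsmulAddMonoidHom_ker (G := ZMod q) a.natAbs
  rw [Nat.card_zmod, Nat.gcd_eq_right h] at hker
  rw [← hker]
  exact Nat.card_congr (Equiv.subtypeEquivRight fun y => by
    rw [AddMonoidHom.mem_ker, nsmulAddMonoidHom_apply, natAbs_nsmul_eq_zero])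

theorem card_pi_smul_eq_zero {ι : Type*} [Fintype ι] {q k : ℕ} [NeZero q] (f : Fin k ↪ ι)
    {a : Fin k → ℤ} (h : ∀ i, (a i).natAbs ∣ q) :
    Nat.card {y : ι → ZMod q // ∀ i, a i • y (f i) = 0} =
      (∏ i, (a i).natAbs) * q ^ (Fintype.card ι - k) := by
  classical
  let s (j : ι) : Type := {z : ZMod q // ∀ i, f i = j → a i • z = 0}
  have hpi : {y : ι → ZMod q // ∀ i, a i • y (f i) = 0} ≃ ∀ j, s j :=
    (Equiv.subtypeEquivRight fun y => ⟨fun h j i hij => hij ▸ h i, fun h i => h _ i rfl⟩).trans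
      (Equiv.subtypePiEquivPi (p := fun {j} z => ∀ i, f i = j → a i • z = 0))
  have himage (i : Fin k) : Nat.card (s (f i)) = (a i).natAbs := by
    rw [← card_zmod_smul_eq_zero (h i)]
    exact Nat.card_congr (Equiv.subtypeEquivRight fun z => by simp)
  have hcompl (j : ι) (hj : j ∈ (Finset.univ.map f)ᶜ) : Nat.card (s j) = q := by
    have hz (z : ZMod q) (i : Fin k) (hij : f i = j) : a i • z = 0 := by simp [← hij] at hj
    rw [Nat.card_congr (Equiv.subtypeUnivEquiv hz), Nat.card_zmod]
  rw [Nat.card_congr hpi, Nat.card_pi, ← Finset.prod_mul_prod_compl (Finset.univ.map f),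
    Finset.prod_map, Finset.prod_congr rfl hcompl, Finset.prod_congr rfl fun i _ => himage i,
    Finset.prod_const, Finset.card_compl, Finset.card_map, Finset.card_univ, Fintype.card_fin]

variable {V : Type*} [AddCommGroup V] {Λ : Submodule ℤ V}

/-- The vectors of the lattice `Λ` killed by a homomorphism `f`, as a sublattice of the ambient
space: the vector `v` belongs to it when the subtorus of `Hom(Λ, R)` defined by `v` contains `f`. -/
def torusKer {R : Type*} [AddCommGroup R] (f : Λ →ₗ[ℤ] R) : Submodule ℤ V :=
  (LinearMap.ker f).map Λ.subtype

theorem coe_mem_torusKer {R : Type*} [AddCommGroup R] {f : Λ →ₗ[ℤ] R} {v : Λ} :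
    (v : V) ∈ torusKer f ↔ f v = 0 := by
  simp [torusKer]

open Classical in
/-- The sum over the points of the finite torus `Hom(Λ, ℤ/q)` of `t` to the number of vectors of
`A` whose subtorus contains the point; by the finite field method it evaluates the coboundary
polynomial at `X = q`, `Y = t`. -/
noncomputable def torusSum {K : Type*} [CommRing K] (Λ : Submodule ℤ V) (A : Finset V) (t : K)
    (q : ℕ) : K :=
  ∑ᶠ f : Λ →ₗ[ℤ] ZMod q, ∏ v ∈ A, if v ∈ torusKer f then t else 1

theorem finite_hom_zmod {ι : Type*} [Finite ι] (b : Basis ι ℤ Λ) (q : ℕ) [NeZero q] :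
    Finite (Λ →ₗ[ℤ] ZMod q) :=
  Finite.of_equiv _ (b.constr (M' := ZMod q) ℤ).toEquiv

variable [Module ℝ V] {ι : Type*} {b : Basis ι ℤ Λ} {A B : Finset V}

theorem multiplicity_ne_zero [Finite ι] (hb : LinearIndependent ℝ fun i => (b i : V))
    (hB : (B : Set V) ⊆ Λ) : multiplicity Λ B ≠ 0 := by
  obtain ⟨b', k, f, a, ha, hBa⟩ := exists_adapted_basis b hB
  rw [multiplicity_eq_of_adapted (linearIndependent_coe_basis hb b') ha hBa]
  exact Finset.prod_ne_zero_iff.2 fun i _ => Int.natAbs_ne_zero.2 (ha i)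

theorem card_subset_torusKer [Fintype ι] (hb : LinearIndependent ℝ fun i => (b i : V))
    (hB : (B : Set V) ⊆ Λ) {q : ℕ} [NeZero q] (hq : multiplicity Λ B ∣ q) :
    Nat.card {f : Λ →ₗ[ℤ] ZMod q // (B : Set V) ⊆ torusKer f} =
      multiplicity Λ B * q ^ (Fintype.card ι - rank B) := by
  obtain ⟨b', k, f, a, ha, hBa⟩ := exists_adapted_basis b hB
  have hb' := linearIndependent_coe_basis hb b'
  have hm := multiplicity_eq_of_adapted hb' ha hBa
  rw [rank_eq_of_adapted hb' ha hBa, hm, ← card_pi_smul_eq_zero f fun i =>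
    (Finset.dvd_prod_of_mem (fun i => (a i).natAbs) (Finset.mem_univ i)).trans (hm ▸ hq)]
  refine Nat.card_congr
    (Equiv.subtypeEquiv (b'.constr (M' := ZMod q) ℤ).symm.toEquiv fun g => ?_)
  rw [← span_le, hBa, span_le, Set.range_subset_iff]
  refine forall_congr' fun i => ?_
  rw [SetLike.mem_coe, ← coe_smul, coe_mem_torusKer, map_smul]
  rfl

theorem torusSum_eq [Fintype ι] (hb : LinearIndependent ℝ fun i => (b i : V))
    (hA : (A : Set V) ⊆ Λ) {K : Type*} [CommRing K] (t : K) {q : ℕ} [NeZero q]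
    (hq : ∀ B ⊆ A, multiplicity Λ B ∣ q) :
    torusSum Λ A t q = ∑ B ∈ A.powerset,
      (multiplicity Λ B : K) * (t - 1) ^ B.card * (q : K) ^ (Fintype.card ι - rank B) := by
  classical
  have := finite_hom_zmod b q
  have := Fintype.ofFinite (Λ →ₗ[ℤ] ZMod q)
  have hexpand (f : Λ →ₗ[ℤ] ZMod q) : ∏ v ∈ A, (if v ∈ torusKer f then t else 1) =
      ∑ B ∈ A.powerset, if (B : Set V) ⊆ torusKer f then (t - 1) ^ B.card else 0 := by
    have hite (v : V) : (if v ∈ torusKer f then t else 1) =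
        1 + if v ∈ torusKer f then t - 1 else 0 := by split_ifs <;> ring
    simp_rw [hite, Finset.prod_one_add, Finset.prod_ite_zero, Finset.prod_const]
    exact Finset.sum_congr rfl fun B _ => if_congr Iff.rfl rfl rfl
  rw [torusSum, finsum_eq_sum_of_fintype]
  simp_rw [hexpand]
  rw [Finset.sum_comm]
  refine Finset.sum_congr rfl fun B hB => ?_
  have hBA := Finset.mem_powerset.1 hB
  rw [← Finset.sum_filter, Finset.sum_const, ← Fintype.card_subtype, ← Nat.card_eq_fintype_card,
    card_subset_torusKer hb ((Finset.coe_subset.2 hBA).trans hA) (hq B hBA), nsmul_eq_mul]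
  push_cast
  ring

theorem rank_mono (h : B ⊆ A) : rank B ≤ rank A :=
  have : FiniteDimensional ℝ (span ℝ (A : Set V)) := FiniteDimensional.span_finset ℝ A
  finrank_mono (span_mono (Finset.coe_subset.2 h))

theorem rank_le_card [Fintype ι] (b : Basis ι ℤ Λ) (hA : (A : Set V) ⊆ Λ) :
    rank A ≤ Fintype.card ι := by
  have : FiniteDimensional ℝ (span ℝ (Set.range fun i => (b i : V))) :=
    FiniteDimensional.span_of_finite ℝ (Set.finite_range _)
  refine (finrank_mono (span_le.2 (hA.trans ?_))).trans
    (finrank_range_le_card fun i => (b i : V))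
  exact (span_range_coe_basis b).ge.trans (span_le_restrictScalars ℤ ℝ _)

theorem varY_sub_one_ne_zero : varY - 1 ≠ 0 := by
  rw [varY, ← map_one (algebraMap (MvPolynomial (Fin 2) ℂ) RatXY), ← map_sub]
  refine (map_ne_zero_iff _ (IsFractionRing.injective _ _)).2 fun h => ?_
  simpa using congrArg (MvPolynomial.eval fun _ => (0 : ℂ)) h

theorem coboundary_eq_sum (Λ : Submodule ℤ V) (A : Finset V) :
    coboundary Λ A = ∑ B ∈ A.powerset,
      (multiplicity Λ B : RatXY) * (varY - 1) ^ B.card * varX ^ (rank A - rank B) := by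
  have hY := varY_sub_one_ne_zero
  rw [coboundary, arithmeticTutte, map_sum, Finset.mul_sum]
  refine Finset.sum_congr rfl fun B hB => ?_
  have hx : (varX + varY - 1) / (varY - 1) - 1 = varX / (varY - 1) := by
    field_simp
    ring
  simp only [map_mul, map_natCast, map_pow, map_sub, MvPolynomial.aeval_X, map_one,
    Matrix.cons_val_zero, Matrix.cons_val_one]
  rw [hx, div_pow]
  obtain ⟨u, hu⟩ := Nat.exists_eq_add_of_le (rank_mono (Finset.mem_powerset.1 hB))
  obtain ⟨v, hv⟩ : ∃ v, B.card = rank B + v :=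
    Nat.exists_eq_add_of_le (finrank_span_finset_le_card B)
  rw [hu, hv, Nat.add_sub_cancel_left, Nat.add_sub_cancel_left, pow_add, pow_add]
  field_simp

/-- The polynomial `X ^ (r - r(A)) * ψ_A(X, Y)` in `X`, for `A` in a lattice of rank `r`, with the
coefficient `Y` specialised to `varY`. -/
noncomputable def coboundaryPolynomial (Λ : Submodule ℤ V) (A : Finset V) (r : ℕ) :
    Polynomial RatXY :=
  ∑ B ∈ A.powerset, Polynomial.C ((multiplicity Λ B : RatXY) * (varY - 1) ^ B.card) *
    Polynomial.X ^ (r - rank B)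

theorem eval_coboundaryPolynomial (Λ : Submodule ℤ V) (A : Finset V) (r : ℕ) (x : RatXY) :
    (coboundaryPolynomial Λ A r).eval x = ∑ B ∈ A.powerset,
      (multiplicity Λ B : RatXY) * (varY - 1) ^ B.card * x ^ (r - rank B) := by
  rw [coboundaryPolynomial, Polynomial.eval_finsetSum]
  refine Finset.sum_congr rfl fun B _ => ?_
  rw [Polynomial.eval_C_mul, Polynomial.eval_pow, Polynomial.eval_X]

theorem eval_varX_coboundaryPolynomial {r : ℕ} (hr : rank A ≤ r) :
    (coboundaryPolynomial Λ A r).eval varX = varX ^ (r - rank A) * coboundary Λ A := by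
  rw [eval_coboundaryPolynomial, coboundary_eq_sum, Finset.mul_sum]
  refine Finset.sum_congr rfl fun B hB => ?_
  rw [← Nat.sub_add_sub_cancel hr (rank_mono (Finset.mem_powerset.1 hB)), pow_add]
  ring

open PowerSeries in
theorem coboundary_eq_coeff_of_torusSum [Fintype ι] {f : RatXY → PowerSeries RatXY}
    (hf : IsPolynomialFamily f) (hb : LinearIndependent ℝ fun i => (b i : V))
    (hA : (A : Set V) ⊆ Λ) {n k d : ℕ} (hd : d ≠ 0)
    (h : ∀ q : ℕ, q ≠ 0 → d ∣ q →
      (q : RatXY) ^ k * torusSum Λ A varY q = n.factorial * coeff n (f q)) :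
    varX ^ (k + (Fintype.card ι - rank A)) * coboundary Λ A / n.factorial =
      coeff n (f varX) := by
  obtain ⟨P, hP⟩ := hf n
  have hn : (n.factorial : RatXY) ≠ 0 := Nat.cast_ne_zero.2 n.factorial_ne_zero
  have hm : ∏ B ∈ A.powerset, multiplicity Λ B ≠ 0 := Finset.prod_ne_zero_iff.2 fun B hB =>
    multiplicity_ne_zero hb ((Finset.coe_subset.2 (Finset.mem_powerset.1 hB)).trans hA)
  have heval := eval_eq_of_dvd (P := Polynomial.X ^ k * coboundaryPolynomial Λ A (Fintype.card ι))
    (Q := Polynomial.C (n.factorial : RatXY) * P) (mul_ne_zero hd hm) (fun q hq hdvd => by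
      have : NeZero q := ⟨hq⟩
      have hmq (B : Finset V) (hB : B ⊆ A) : multiplicity Λ B ∣ q :=
        (Finset.dvd_prod_of_mem _ (Finset.mem_powerset.2 hB)).trans
          ((dvd_mul_left _ _).trans hdvd)
      rw [Polynomial.eval_mul, Polynomial.eval_pow, Polynomial.eval_X, Polynomial.eval_C_mul, ← hP,
        ← h q hq ((dvd_mul_right _ _).trans hdvd), torusSum_eq hb hA _ hmq,
        eval_coboundaryPolynomial]) varX
  rw [Polynomial.eval_mul, Polynomial.eval_pow, Polynomial.eval_X, Polynomial.eval_C_mul, ← hP,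
    eval_varX_coboundaryPolynomial (rank_le_card b hA), ← mul_assoc, ← pow_add] at heval
  rw [heval, mul_div_cancel_left₀ _ hn]

end TorusCounting

section SignedColourings

open Finset

/-- The class modulo sign of an element of `ℤ/2N`: the representative in `{0, …, N}` of `±a`. -/
def signClass {N : ℕ} [NeZero N] (a : ZMod (2 * N)) : Fin (N + 1) :=
  ⟨a.valMinAbs.natAbs, Nat.lt_succ_of_le ((ZMod.natAbs_valMinAbs_le a).trans (by lia))⟩

variable {N : ℕ} [NeZero N]

theorem signClass_eq_iff {a b : ZMod (2 * N)} : signClass a = signClass b ↔ a = b ∨ a = -b := by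
  rw [← ZMod.natAbs_valMinAbs_eq_natAbs_valMinAbs, signClass, signClass, Fin.mk.injEq]

theorem signClass_natCast (k : Fin (N + 1)) : signClass ((k : ℕ) : ZMod (2 * N)) = k :=
  Fin.ext <| congrArg Int.natAbs (ZMod.valMinAbs_natCast_of_le_half (by lia))

theorem eq_neg_iff_signClass {a : ZMod (2 * N)} :
    a = -a ↔ (signClass a : ℕ) = 0 ∨ (signClass a : ℕ) = N := by
  have hlt := a.val_lt
  have hcoe : (signClass a : ℕ) = a.valMinAbs.natAbs := rfl
  rw [eq_comm, ZMod.neg_eq_self_iff, hcoe, ZMod.valMinAbs_def_pos, ← ZMod.val_eq_zero]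
  split_ifs <;> lia

theorem card_signClass_fiber (k : Fin (N + 1)) :
    #{a : ZMod (2 * N) | signClass a = k} = if (k : ℕ) = 0 ∨ (k : ℕ) = N then 1 else 2 := by
  have hfiber : ({a | signClass a = k} : Finset (ZMod (2 * N))) =
      {((k : ℕ) : ZMod (2 * N)), -((k : ℕ) : ZMod (2 * N))} := by
    ext a
    rw [mem_filter_univ, mem_insert, mem_singleton, ← signClass_eq_iff, signClass_natCast]
  have hneg := eq_neg_iff_signClass (a := ((k : ℕ) : ZMod (2 * N)))
  rw [signClass_natCast] at hneg
  rw [hfiber]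
  split_ifs with h
  · rw [← hneg.2 h, pair_eq_singleton, card_singleton]
  · exact card_pair fun h' => h (hneg.1 h')

theorem apply_natCast_signClass {α : Type*} {h : ZMod (2 * N) → α} (hh : h.Even)
    (a : ZMod (2 * N)) : h ((signClass a : ℕ) : ZMod (2 * N)) = h a := by
  rcases signClass_eq_iff.1 (signClass_natCast (signClass a)) with ha | ha <;> rw [ha]
  exact hh a

variable {K : Type*} [Field K] (Y : K)

/-- The contribution to `torusSum` of the roots `e i - e j` and `e i + e j` at the point with
coordinates `x`. -/
def signedWeight {G : Type*} [Neg G] [DecidableEq G] {n : ℕ} (x : Fin n → G) : K :=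
  ∏ p ∈ pairs n, (if x p.1 = x p.2 then Y else 1) * (if x p.1 = -x p.2 then Y else 1)

theorem signedWeight_eq_prod_signClass {n : ℕ} (x : Fin n → ZMod (2 * N)) :
    signedWeight Y x = ∏ p ∈ pairs n, if signClass (x p.1) = signClass (x p.2) then
      (if (signClass (x p.1) : ℕ) = 0 ∨ (signClass (x p.1) : ℕ) = N then Y ^ 2 else Y)
      else 1 := by
  refine prod_congr rfl fun p _ => ?_
  simp only [signClass_eq_iff, ← eq_neg_iff_signClass]
  generalize x p.1 = a
  generalize x p.2 = b
  grind

/-- Colours modulo sign fall into the classes `{0}`, `{N}` and `{k, -k}` with `0 < k < N`; two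
coordinates in one class meet both conditions `a = b` and `a = -b` in the first two cases, and
exactly one of them otherwise. -/
theorem sum_signedWeight [CharZero K] {h : ZMod (2 * N) → K} (hh : h.Even) (n : ℕ) :
    ∑ x : Fin n → ZMod (2 * N), signedWeight Y x * ∏ i, h (x i) =
      n.factorial * PowerSeries.coeff n (deformedExp (h 0) (Y ^ 2) * deformedExp (h N) (Y ^ 2) *
        ∏ k ∈ range (N - 1), deformedExp (2 * h (k + 1 : ℕ)) Y) := by
  have hcomp := sum_comp_eq_sum_card_fiber (n := n) (signClass (N := N)) fun c =>
    (∏ p ∈ pairs n, if c p.1 = c p.2 then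
      (if (c p.1 : ℕ) = 0 ∨ (c p.1 : ℕ) = N then Y ^ 2 else Y) else 1) *
        ∏ i, h ((c i : ℕ) : ZMod (2 * N))
  simp only [Function.comp_apply, ← signedWeight_eq_prod_signClass, apply_natCast_signClass hh,
    card_signClass_fiber, mul_assoc, ← prod_mul_distrib] at hcomp
  rw [hcomp, sum_colourings n (fun k : Fin (N + 1) => if (k : ℕ) = 0 ∨ (k : ℕ) = N then Y ^ 2
    else Y) fun k : Fin (N + 1) => h ((k : ℕ) : ZMod (2 * N)) *
      ((if (k : ℕ) = 0 ∨ (k : ℕ) = N then 1 else 2 : ℕ) : K),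
    Fin.prod_univ_eq_prod_range (fun k => deformedExp (h (k : ZMod (2 * N)) *
      ((if k = 0 ∨ k = N then 1 else 2 : ℕ) : K)) (if k = 0 ∨ k = N then Y ^ 2 else Y))]
  congr 2
  obtain ⟨l, rfl⟩ := Nat.exists_eq_succ_of_ne_zero (NeZero.ne N)
  have hmid : ∀ k ∈ range l, deformedExp (h ((k + 1 : ℕ) : ZMod (2 * (l + 1))) *
      ((if k + 1 = 0 ∨ k + 1 = l + 1 then 1 else 2 : ℕ) : K))
        (if k + 1 = 0 ∨ k + 1 = l + 1 then Y ^ 2 else Y) =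
      deformedExp (2 * h (k + 1 : ℕ)) Y := fun k hk => by
    rw [if_neg (by grind), if_neg (by grind), Nat.cast_two, mul_comm]
  rw [prod_range_succ, prod_range_succ', prod_congr rfl hmid]
  simp only [true_or, or_true, if_true, Nat.cast_one, mul_one, Nat.cast_zero, Nat.succ_eq_add_one,
    Nat.add_sub_cancel]
  ring

theorem prod_range_alternating {M : Type*} [CommMonoid M] (u : ℕ → M) (a b : M) (j : ℕ)
    (ha : ∀ k, u (2 * k) = a) (hb : ∀ k, u (2 * k + 1) = b) :
    ∏ k ∈ range (2 * j + 1), u k = b ^ j * a ^ (j + 1) := by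
  induction j with
  | zero => simp [ha 0]
  | succ j ih =>
    rw [mul_add, mul_one, prod_range_succ, prod_range_succ, ih, hb, ← mul_add_one, ha,
      pow_succ b, pow_succ a (j + 1)]
    ac_rfl

end SignedColourings

section Roots

open Finset Submodule

variable {n : ℕ} {i j k l : Fin n}

theorem e_apply (i k : Fin n) : (e i : Fin n → ℝ) k = if k = i then 1 else 0 := by
  rw [e, Pi.single_apply]

theorem mem_pairs {p : Fin n × Fin n} : p ∈ pairs n ↔ p.1 < p.2 := by
  rw [pairs, mem_filter_univ]

theorem e_sub_e_inj (h : i < j) (he : (e i - e j : Fin n → ℝ) = e k - e l) : i = k ∧ j = l := by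
  have hi := congrFun he i
  have hj := congrFun he j
  simp only [Pi.sub_apply, e_apply] at hi hj
  grind

theorem e_add_e_inj (h : i < j) (h' : k < l) (he : (e i + e j : Fin n → ℝ) = e k + e l) :
    i = k ∧ j = l := by
  have hi := congrFun he i
  have hj := congrFun he j
  simp only [Pi.add_apply, e_apply] at hi hj
  grind

theorem e_sub_e_ne_e_add_e (h : i < j) : (e i - e j : Fin n → ℝ) ≠ e k + e l := fun he => by
  have hj := congrFun he j
  simp only [Pi.sub_apply, Pi.add_apply, e_apply] at hj
  grind

theorem e_sub_e_ne_smul_e (h : i < j) {a : ℝ} (ha : 0 ≤ a) :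
    (e i - e j : Fin n → ℝ) ≠ a • e k := fun he => by
  have hj := congrFun he j
  simp only [Pi.sub_apply, Pi.smul_apply, e_apply, smul_eq_mul] at hj
  grind

theorem e_add_e_ne_smul_e (h : i < j) (a : ℝ) : (e i + e j : Fin n → ℝ) ≠ a • e k := fun he => by
  have hi := congrFun he i
  have hj := congrFun he j
  simp only [Pi.add_apply, Pi.smul_apply, e_apply, smul_eq_mul] at hi hj
  grind

theorem smul_e_injective {a : ℝ} (ha : a ≠ 0) :
    Function.Injective fun i : Fin n => a • (e i : Fin n → ℝ) := fun i j h => by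
  have hi := congrFun h i
  simp only [Pi.smul_apply, e_apply, smul_eq_mul] at hi
  grind

theorem mem_rootsD {v : Fin n → ℝ} :
    v ∈ rootsD n ↔ ∃ i j, i < j ∧ (v = e i - e j ∨ v = e i + e j) := by
  classical
  simp only [rootsD, mem_union, mem_image, mem_pairs, Prod.exists, ← exists_or, ← and_or_left,
    eq_comm (a := v)]

theorem prod_rootsD {M : Type*} [CommMonoid M] (φ : (Fin n → ℝ) → M) :
    ∏ v ∈ rootsD n, φ v = ∏ p ∈ pairs n, φ (e p.1 - e p.2) * φ (e p.1 + e p.2) := by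
  classical
  have hdisj : Disjoint ((pairs n).image fun p => (e p.1 - e p.2 : Fin n → ℝ))
      ((pairs n).image fun p => e p.1 + e p.2) := Finset.disjoint_left.2 fun v hv hv' => by
    obtain ⟨p, hp, rfl⟩ := mem_image.1 hv
    obtain ⟨p', -, h⟩ := mem_image.1 hv'
    exact e_sub_e_ne_e_add_e (mem_pairs.1 hp) h.symm
  rw [prod_mul_distrib, rootsD, prod_union hdisj,
    prod_image fun p hp p' _ h => Prod.ext_iff.2 (e_sub_e_inj (mem_pairs.1 hp) h),
    prod_image fun p hp p' hp' h =>
      Prod.ext_iff.2 (e_add_e_inj (mem_pairs.1 hp) (mem_pairs.1 hp') h)]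

open Classical in
theorem prod_rootsD_union {M : Type*} [CommMonoid M] (φ : (Fin n → ℝ) → M) {a : ℝ} (ha : 0 < a) :
    ∏ v ∈ rootsD n ∪ univ.image (fun i => a • e i), φ v =
      (∏ p ∈ pairs n, φ (e p.1 - e p.2) * φ (e p.1 + e p.2)) * ∏ i, φ (a • e i) := by
  rw [prod_union, prod_rootsD, prod_image fun i _ j _ h => smul_e_injective ha.ne' h]
  refine Finset.disjoint_left.2 fun v hv hv' => ?_
  obtain ⟨k, -, rfl⟩ := mem_image.1 hv'
  obtain ⟨i, j, hij, h | h⟩ := mem_rootsD.1 hv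
  · exact e_sub_e_ne_smul_e hij ha.le h.symm
  · exact e_add_e_ne_smul_e hij a h.symm

theorem prod_rootsB {M : Type*} [CommMonoid M] (φ : (Fin n → ℝ) → M) :
    ∏ v ∈ rootsB n, φ v =
      (∏ p ∈ pairs n, φ (e p.1 - e p.2) * φ (e p.1 + e p.2)) * ∏ i, φ (e i) := by
  have h := prod_rootsD_union φ one_pos
  simp only [one_smul] at h
  exact h

theorem prod_rootsC {M : Type*} [CommMonoid M] (φ : (Fin n → ℝ) → M) :
    ∏ v ∈ rootsC n, φ v =
      (∏ p ∈ pairs n, φ (e p.1 - e p.2) * φ (e p.1 + e p.2)) * ∏ i, φ ((2 : ℝ) • e i) :=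
  prod_rootsD_union φ two_pos

theorem e_mem_integerLattice (i : Fin n) : e i ∈ integerLattice n :=
  subset_span (Set.mem_range_self i)

theorem rootsD_subset (n : ℕ) : (rootsD n : Set (Fin n → ℝ)) ⊆ integerLattice n := by
  intro v hv
  obtain ⟨i, j, -, rfl | rfl⟩ := mem_rootsD.1 hv
  · exact sub_mem (e_mem_integerLattice i) (e_mem_integerLattice j)
  · exact add_mem (e_mem_integerLattice i) (e_mem_integerLattice j)

theorem rootsB_subset (n : ℕ) : (rootsB n : Set (Fin n → ℝ)) ⊆ integerLattice n := by
  classical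
  rw [rootsB, coe_union, coe_image, Set.union_subset_iff, Set.image_subset_iff]
  exact ⟨rootsD_subset n, fun i _ => e_mem_integerLattice i⟩

theorem rootsC_subset (n : ℕ) : (rootsC n : Set (Fin n → ℝ)) ⊆ integerLattice n := by
  classical
  rw [rootsC, coe_union, coe_image, Set.union_subset_iff, Set.image_subset_iff]
  refine ⟨rootsD_subset n, fun i _ => ?_⟩
  rw [Set.mem_preimage, two_smul]
  exact add_mem (e_mem_integerLattice i) (e_mem_integerLattice i)

theorem e_eq_basisFun (n : ℕ) : (e : Fin n → Fin n → ℝ) = Pi.basisFun ℝ (Fin n) := by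
  ext i : 1
  rw [Pi.basisFun_apply, e]

theorem rank_eq_of_e_mem {A : Finset (Fin n → ℝ)}
    (h : ∀ i, e i ∈ span ℝ (A : Set (Fin n → ℝ))) : rank A = n := by
  have htop : span ℝ (A : Set (Fin n → ℝ)) = ⊤ := by
    rw [eq_top_iff, ← (Pi.basisFun ℝ (Fin n)).span_eq, ← e_eq_basisFun, span_le]
    exact Set.range_subset_iff.2 h
  rw [rank, htop, finrank_top, Module.finrank_fin_fun]

theorem rank_rootsB (n : ℕ) : rank (rootsB n) = n := by
  classical
  exact rank_eq_of_e_mem fun i =>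
    subset_span (mem_union_right _ (mem_image_of_mem _ (mem_univ i)))

theorem rank_rootsC (n : ℕ) : rank (rootsC n) = n := by
  classical
  refine rank_eq_of_e_mem fun i => ?_
  rw [← smul_mem_iff _ (two_ne_zero (α := ℝ))]
  exact subset_span (mem_union_right _ (mem_image_of_mem _ (mem_univ i)))

theorem rank_rootsD (hn : 2 ≤ n) : rank (rootsD n) = n := by
  have hmem (i j : Fin n) (hij : i < j) : e i ∈ span ℝ (rootsD n : Set (Fin n → ℝ)) ∧
      e j ∈ span ℝ (rootsD n : Set (Fin n → ℝ)) := by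
    have hsub : (e i - e j : Fin n → ℝ) ∈ span ℝ (rootsD n : Set (Fin n → ℝ)) :=
      subset_span (mem_rootsD.2 ⟨i, j, hij, Or.inl rfl⟩)
    have hadd : (e i + e j : Fin n → ℝ) ∈ span ℝ (rootsD n : Set (Fin n → ℝ)) :=
      subset_span (mem_rootsD.2 ⟨i, j, hij, Or.inr rfl⟩)
    rw [← smul_mem_iff _ (two_ne_zero (α := ℝ)), ← smul_mem_iff (x := e j) _
      (two_ne_zero (α := ℝ)), two_smul, two_smul]
    exact ⟨by simpa using add_mem hsub hadd, by simpa using sub_mem hadd hsub⟩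
  refine rank_eq_of_e_mem fun i => ?_
  have : Nontrivial (Fin n) := Fin.nontrivial_iff_two_le.2 hn
  obtain ⟨j, hj⟩ := exists_ne i
  rcases lt_or_gt_of_ne hj with h | h
  · exact (hmem j i h).2
  · exact (hmem i j h).1

theorem rootsD_eq_empty (hn : n ≤ 1) : rootsD n = ∅ := by
  refine Finset.eq_empty_of_forall_notMem fun v hv => ?_
  obtain ⟨i, j, h, -⟩ := mem_rootsD.1 hv
  lia

theorem coboundary_empty {V : Type*} [AddCommGroup V] [Module ℝ V] (Λ : Submodule ℤ V) :
    coboundary Λ ∅ = 1 := by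
  rw [coboundary_eq_sum, powerset_empty, sum_singleton]
  simp [multiplicity]

end Roots

section SignedSeries

open Finset PowerSeries

variable {K : Type*} [Field K]

theorem addChar_sum_eq_prod {A M κ : Type*} [AddCommMonoid A] [CommMonoid M] (ψ : AddChar A M)
    (s : Finset κ) (x : κ → A) : ψ (∑ i ∈ s, x i) = ∏ i ∈ s, ψ (x i) := by
  classical
  induction s using Finset.induction_on with
  | empty => simp
  | insert i s hi ih => rw [sum_insert hi, prod_insert hi, AddChar.map_add_eq_mul, ih]

/-- The character `a ↦ (-1) ^ a` of `ℤ/2N`. -/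
noncomputable def parityChar (K : Type*) [Field K] (N : ℕ) [NeZero N] : AddChar (ZMod (2 * N)) K :=
  AddChar.zmodChar (2 * N) (even_two_mul N).neg_one_pow

variable {N : ℕ} [NeZero N]

theorem parityChar_natCast (k : ℕ) : parityChar K N k = (-1) ^ k :=
  AddChar.zmodChar_apply' _ k

theorem parityChar_mul_self (a : ZMod (2 * N)) : parityChar K N a * parityChar K N a = 1 := by
  rw [← ZMod.natCast_zmod_val a, parityChar_natCast, ← mul_pow, neg_one_mul, neg_neg, one_pow]

theorem even_parityChar : Function.Even (parityChar K N) := fun a => by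
  rw [AddChar.map_neg_eq_inv, inv_eq_of_mul_eq_one_left (parityChar_mul_self a)]

theorem card_two_nsmul_eq [CharZero K] (a : ZMod (2 * N)) :
    (Nat.card {y : ZMod (2 * N) // 2 • y = a} : K) = 1 + parityChar K N a := by
  by_cases h : ∃ z, 2 • z = a
  · obtain ⟨z, rfl⟩ := h
    have hcard : Nat.card {y : ZMod (2 * N) // 2 • y = 2 • z} = 2 := by
      refine (Nat.card_congr ?_).trans
        (card_zmod_smul_eq_zero (q := 2 * N) (a := 2) (Nat.dvd_mul_right 2 N))
      refine Equiv.subtypeEquiv (Equiv.subRight z) fun y => ?_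
      rw [Equiv.subRight_apply, smul_sub, sub_eq_zero, ofNat_zsmul, ofNat_zsmul]
    rw [hcard, two_nsmul, AddChar.map_add_eq_mul, parityChar_mul_self, one_add_one_eq_two,
      Nat.cast_two]
  · have hodd : Odd a.val := Nat.not_even_iff_odd.1 fun ⟨k, hk⟩ => h ⟨k, by
      rw [← ZMod.natCast_zmod_val a, hk, Nat.cast_add, two_nsmul]⟩
    have : IsEmpty {y : ZMod (2 * N) // 2 • y = a} := ⟨fun y => h ⟨y, y.2⟩⟩
    rw [Nat.card_of_isEmpty, ← ZMod.natCast_zmod_val a, parityChar_natCast, hodd.neg_one_pow,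
      Nat.cast_zero, add_neg_cancel]

theorem natCast_ne_zero_of_lt {m k : ℕ} (hk : k ≠ 0) (hm : k < m) : (k : ZMod m) ≠ 0 := fun h =>
  hk (Nat.eq_zero_of_dvd_of_lt ((ZMod.natCast_eq_zero_iff k m).1 h) hm)

theorem constantCoeff_deformedExp (α β : K) : constantCoeff (deformedExp α β) = 1 := by
  rw [← coeff_zero_eq_constantCoeff_apply]
  simp [deformedExp]

/-- The right-hand sides of the formulas in types `B` (`t = Y`) and `D` (`t = 1`) at `X = c`. -/
noncomputable def halfSeries [BinomialRing K] (Y t c : K) : PowerSeries K :=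
  binomialPower (deformedExp 2 Y) (c / 4 - 1) * deformedExp 1 (Y ^ 2) * deformedExp t (Y ^ 2) *
    (binomialPower (deformedExp 2 Y) (c / 4) + binomialPower (deformedExp (-2) Y) (c / 4))

/-- The right-hand side of the formula in type `C` at `X = c`. -/
noncomputable def integerSeries [BinomialRing K] (Y c : K) : PowerSeries K :=
  binomialPower (deformedExp 2 Y) (c / 2 - 1) * deformedExp Y (Y ^ 2) ^ 2

theorem constantCoeff_halfSeries [BinomialRing K] (Y t c : K) :
    constantCoeff (halfSeries Y t c) = 2 := by
  simp only [halfSeries, map_mul, map_add, constantCoeff_binomialPower,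
    constantCoeff_deformedExp, one_mul, one_add_one_eq_two]

variable [CharZero K] (Y t : K)

theorem sum_signedWeight_mul_ite_zero (n : ℕ) :
    ∑ x : Fin n → ZMod (2 * N), signedWeight Y x * ∏ i, (if x i = 0 then t else 1) =
      n.factorial * coeff n (deformedExp t (Y ^ 2) * deformedExp 1 (Y ^ 2) *
        deformedExp 2 Y ^ (N - 1)) := by
  have hN := NeZero.ne N
  rw [sum_signedWeight Y (h := fun a => if a = 0 then t else 1)
      (fun a => if_congr neg_eq_zero rfl rfl), if_pos rfl,
    if_neg (natCast_ne_zero_of_lt hN (by lia)), prod_congr rfl fun k hk => by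
      rw [if_neg (natCast_ne_zero_of_lt k.succ_ne_zero (by grind)), mul_one],
    prod_const, card_range]

theorem sum_signedWeight_mul_ite_eq_neg (n : ℕ) :
    ∑ x : Fin n → ZMod (2 * N), signedWeight Y x * ∏ i, (if x i = -x i then t else 1) =
      n.factorial * coeff n (deformedExp t (Y ^ 2) * deformedExp t (Y ^ 2) *
        deformedExp 2 Y ^ (N - 1)) := by
  have hN : (N : ZMod (2 * N)) = -N := by
    rw [eq_neg_iff_add_eq_zero, ← two_mul]
    exact_mod_cast ZMod.natCast_self (2 * N)
  have hmid (k : ℕ) (hk : k ∈ range (N - 1)) :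
      ((k + 1 : ℕ) : ZMod (2 * N)) ≠ -((k + 1 : ℕ) : ZMod (2 * N)) := by
    rw [Ne, eq_neg_iff_add_eq_zero, ← Nat.cast_add]
    exact natCast_ne_zero_of_lt (by lia) (by grind)
  rw [sum_signedWeight Y (h := fun a => if a = -a then t else 1) fun a => if_congr
      (by rw [neg_neg, eq_comm]) rfl rfl, if_pos neg_zero.symm, if_pos hN,
    prod_congr rfl fun k hk => by rw [if_neg (hmid k hk), mul_one], prod_const, card_range]

theorem sum_parityChar_mul_signedWeight (n j : ℕ) :
    ∑ x : Fin n → ZMod (2 * (2 * (j + 1))), parityChar K (2 * (j + 1)) (∑ i, x i) *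
        (signedWeight Y x * ∏ i, (if x i = 0 then t else 1)) =
      n.factorial * coeff n (deformedExp t (Y ^ 2) * deformedExp 1 (Y ^ 2) *
        (deformedExp 2 Y ^ j * deformedExp (-2) Y ^ (j + 1))) := by
  have hx (x : Fin n → ZMod (2 * (2 * (j + 1)))) : parityChar K (2 * (j + 1)) (∑ i, x i) *
      (signedWeight Y x * ∏ i, (if x i = 0 then t else 1)) = signedWeight Y x *
        ∏ i, parityChar K (2 * (j + 1)) (x i) * (if x i = 0 then t else 1) := by
    rw [addChar_sum_eq_prod, prod_mul_distrib]
    ring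
  have heven : Function.Even fun a : ZMod (2 * (2 * (j + 1))) =>
      parityChar K (2 * (j + 1)) a * (if a = 0 then t else 1) := fun a => by
    simp only [even_parityChar a, neg_eq_zero]
  have hmid (k : ℕ) (hk : k ∈ range (2 * (j + 1) - 1)) :
      deformedExp (2 * (parityChar K (2 * (j + 1)) (k + 1 : ℕ) *
        (if ((k + 1 : ℕ) : ZMod (2 * (2 * (j + 1)))) = 0 then t else 1))) Y =
      deformedExp (2 * (-1) ^ (k + 1)) Y := by
    rw [parityChar_natCast, if_neg (natCast_ne_zero_of_lt k.succ_ne_zero (by grind)), mul_one]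
  rw [sum_congr rfl fun x _ => hx x, sum_signedWeight Y heven, prod_congr rfl hmid,
    parityChar_natCast, (even_two_mul _).neg_one_pow, AddChar.map_zero_eq_one, one_mul, one_mul,
    if_pos rfl, if_neg (natCast_ne_zero_of_lt (by lia) (by lia)),
    show 2 * (j + 1) - 1 = 2 * j + 1 by lia,
    prod_range_alternating _ (deformedExp (-2) Y) (deformedExp 2 Y) j
      (fun k => by rw [(odd_two_mul_add_one k).neg_one_pow, mul_neg_one])
      (fun k => by rw [(odd_two_mul_add_one k).add_one.neg_one_pow, mul_one])]

variable [BinomialRing K]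

theorem isPolynomialFamily_halfSeries : IsPolynomialFamily (halfSeries Y t) := by
  have h := constantCoeff_deformedExp (K := K)
  exact (((isPolynomialFamily_binomialPower_div_sub (h 2 Y) 4 1).mul (.const _)).mul
    (.const _)).mul ((isPolynomialFamily_binomialPower_div (h 2 Y) 4).add
      (isPolynomialFamily_binomialPower_div (h (-2) Y) 4))

theorem isPolynomialFamily_integerSeries : IsPolynomialFamily (integerSeries Y) :=
  (isPolynomialFamily_binomialPower_div_sub (constantCoeff_deformedExp 2 Y) 2 1).mul (.const _)

theorem sum_signedWeight_eq_halfSeries (n j : ℕ) :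
    ∑ x : Fin n → ZMod (2 * (2 * (j + 1))), (1 + parityChar K (2 * (j + 1)) (∑ i, x i)) *
        (signedWeight Y x * ∏ i, (if x i = 0 then t else 1)) =
      n.factorial * coeff n (halfSeries Y t (2 * (2 * (j + 1)) : ℕ)) := by
  have hdiv : ((2 * (2 * (j + 1)) : ℕ) : K) / 4 = (j + 1 : ℕ) := by
    push_cast
    ring
  have hsub : ((j + 1 : ℕ) : K) - 1 = j := by rw [Nat.cast_succ, add_sub_cancel_right]
  have hpow (α : K) := binomialPower_natCast (constantCoeff_deformedExp α Y)
  rw [halfSeries, hdiv, hsub, hpow, hpow, hpow]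
  simp_rw [add_mul, one_mul]
  rw [sum_add_distrib, sum_signedWeight_mul_ite_zero, sum_parityChar_mul_signedWeight, ← mul_add,
    ← map_add, show 2 * (j + 1) - 1 = j + (j + 1) by lia, pow_add]
  congr 2
  ring

theorem sum_signedWeight_eq_integerSeries (n : ℕ) :
    ∑ x : Fin n → ZMod (2 * N), signedWeight Y x * ∏ i, (if x i = -x i then Y else 1) =
      n.factorial * coeff n (integerSeries Y (2 * N : ℕ)) := by
  have hN : ((2 * N : ℕ) : K) / 2 - 1 = (N - 1 : ℕ) := by
    rw [Nat.cast_pred (NeZero.pos N), Nat.cast_mul, Nat.cast_two,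
      mul_div_cancel_left₀ _ two_ne_zero]
  rw [sum_signedWeight_mul_ite_eq_neg, integerSeries, hN,
    binomialPower_natCast (constantCoeff_deformedExp 2 Y), ← sq, mul_comm (deformedExp _ _ ^ 2)]

end SignedSeries

section TypesBCD

open Finset Submodule Module PowerSeries

theorem finsum_comp_eq_sum_card {K X Y : Type*} [Semiring K] [Finite X] [Fintype Y] (π : X → Y)
    (G : Y → K) : ∑ᶠ x, G (π x) = ∑ y, (Nat.card {x // π x = y} : K) * G y := by
  classical
  have := Fintype.ofFinite X
  rw [finsum_eq_sum_of_fintype, ← sum_fiberwise univ π]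
  refine sum_congr rfl fun y _ => ?_
  rw [sum_congr rfl fun x hx => by rw [(mem_filter.1 hx).2], sum_const, nsmul_eq_mul,
    Nat.card_eq_fintype_card, Fintype.card_subtype]

section TorusSums

variable {n q : ℕ} {Λ : Submodule ℤ (Fin n → ℝ)}

/-- The standard basis vector `e i`, as an element of a lattice containing `ℤⁿ`. -/
def unitVec (h : integerLattice n ≤ Λ) (i : Fin n) : Λ :=
  ⟨e i, h (e_mem_integerLattice i)⟩

variable {K : Type*} [Field K] (Y : K) (h : integerLattice n ≤ Λ)

open Classical in
theorem prod_pairs_torusKer (f : Λ →ₗ[ℤ] ZMod q) :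
    ∏ p ∈ pairs n, (if e p.1 - e p.2 ∈ torusKer f then Y else 1) *
      (if e p.1 + e p.2 ∈ torusKer f then Y else 1) = signedWeight Y fun i => f (unitVec h i) := by
  refine prod_congr rfl fun p _ => congrArg₂ _ (if_congr ?_ rfl rfl) (if_congr ?_ rfl rfl)
  · rw [← sub_eq_zero, ← map_sub, ← coe_mem_torusKer]
    rfl
  · rw [← add_eq_zero_iff_eq_neg, ← map_add, ← coe_mem_torusKer]
    rfl

theorem torusSum_rootsD : torusSum Λ (rootsD n) Y q =
    ∑ᶠ f : Λ →ₗ[ℤ] ZMod q, signedWeight Y fun i => f (unitVec h i) :=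
  finsum_congr fun f => by rw [prod_rootsD, prod_pairs_torusKer Y h]

theorem torusSum_rootsB : torusSum Λ (rootsB n) Y q = ∑ᶠ f : Λ →ₗ[ℤ] ZMod q,
    (signedWeight Y fun i => f (unitVec h i)) * ∏ i, if f (unitVec h i) = 0 then Y else 1 :=
  finsum_congr fun f => by
    classical
    rw [prod_rootsB, prod_pairs_torusKer Y h]
    exact congrArg _ (prod_congr rfl fun i _ =>
      if_congr (coe_mem_torusKer (v := unitVec h i)) rfl rfl)

theorem torusSum_rootsC : torusSum Λ (rootsC n) Y q = ∑ᶠ f : Λ →ₗ[ℤ] ZMod q,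
    (signedWeight Y fun i => f (unitVec h i)) *
      ∏ i, if f (unitVec h i) = -f (unitVec h i) then Y else 1 :=
  finsum_congr fun f => by
    classical
    rw [prod_rootsC, prod_pairs_torusKer Y h]
    refine congrArg _ (prod_congr rfl fun i _ => if_congr ?_ rfl rfl)
    rw [two_smul, ← add_eq_zero_iff_eq_neg, ← map_add, ← coe_mem_torusKer]
    rfl

end TorusSums

section IntegerLattice

theorem exists_basis_integerLattice (n : ℕ) :
    ∃ b : Basis (Fin n) ℤ (integerLattice n), ∀ i, b i = unitVec le_rfl i := by
  have he : LinearIndependent ℝ (e : Fin n → Fin n → ℝ) :=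
    e_eq_basisFun n ▸ (Pi.basisFun ℝ (Fin n)).linearIndependent
  obtain ⟨b, hb⟩ := exists_basis_of_span_eq (he.restrict_scalars' ℤ) rfl
  exact ⟨b, fun i => Subtype.ext (hb i)⟩

theorem PsiC_eq : PsiC = integerSeries varY varX := by
  ext n
  obtain ⟨b, hb⟩ := exists_basis_integerLattice n
  have hcoe : (fun i => (b i : Fin n → ℝ)) = Pi.basisFun ℝ (Fin n) := by
    rw [← e_eq_basisFun]
    exact funext fun i => congrArg Subtype.val (hb i)
  have hcoeff := coboundary_eq_coeff_of_torusSum (k := 0) (isPolynomialFamily_integerSeries varY)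
    (hcoe ▸ (Pi.basisFun ℝ (Fin n)).linearIndependent) (rootsC_subset n) two_ne_zero
    fun q hq hdvd => by
      obtain ⟨N, rfl⟩ := hdvd
      have : NeZero N := ⟨right_ne_zero_of_mul hq⟩
      rw [← sum_signedWeight_eq_integerSeries, pow_zero, one_mul, torusSum_rootsC varY le_rfl,
        ← finsum_eq_sum_of_fintype, ← finsum_comp_equiv (b.constr ℤ).symm.toEquiv]
      simp_rw [← hb]
      rfl
  rw [Fintype.card_fin, rank_rootsC, Nat.sub_self, pow_zero, one_mul] at hcoeff
  rw [PsiC, egf, coeff_mk, hcoeff]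

end IntegerLattice

section HalfLattice

variable {m : ℕ}

theorem integerLattice_le_weightLatticeB (n : ℕ) : integerLattice n ≤ weightLatticeB n :=
  span_mono Set.subset_union_left

/-- The basis `½(e_1 + ⋯ + e_n), e_2, …, e_n` of the weight lattice of `B_n`. -/
noncomputable def halfBasis (m : ℕ) : Fin (m + 1) → Fin (m + 1) → ℝ :=
  Fin.cons ((1 / 2 : ℝ) • ∑ i, e i) fun j => e j.succ

theorem e_zero_eq (m : ℕ) : (e 0 : Fin (m + 1) → ℝ) =
    2 • halfBasis m 0 - ∑ j : Fin m, halfBasis m j.succ := by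
  simp only [halfBasis, Fin.cons_zero, Fin.cons_succ]
  rw [Fin.sum_univ_succ (fun i : Fin (m + 1) => (e i : Fin (m + 1) → ℝ)), ← ofNat_smul_eq_nsmul ℝ,
    smul_smul]
  norm_num

theorem e_mem_span_halfBasis {R : Type*} [Ring R] [Module R (Fin (m + 1) → ℝ)]
    (i : Fin (m + 1)) : e i ∈ span R (Set.range (halfBasis m)) := by
  have hmem (i : Fin (m + 1)) : halfBasis m i ∈ span R (Set.range (halfBasis m)) :=
    subset_span (Set.mem_range_self i)
  refine Fin.cases ?_ (fun j => hmem j.succ) i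
  rw [e_zero_eq]
  exact sub_mem (nsmul_mem (hmem 0) 2) (sum_mem fun j _ => hmem j.succ)

theorem linearIndependent_halfBasis (m : ℕ) : LinearIndependent ℝ (halfBasis m) := by
  refine linearIndependent_of_top_le_span_of_card_eq_finrank ?_ (by simp)
  rw [← (Pi.basisFun ℝ (Fin (m + 1))).span_eq, ← e_eq_basisFun, span_le]
  exact Set.range_subset_iff.2 e_mem_span_halfBasis

theorem span_halfBasis (m : ℕ) : span ℤ (Set.range (halfBasis m)) = weightLatticeB (m + 1) := by
  refine le_antisymm (span_le.2 (Set.range_subset_iff.2 fun i => ?_)) (span_le.2 ?_)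
  · refine Fin.cases ?_ (fun j => ?_) i
    · exact subset_span (Or.inr rfl)
    · exact subset_span (Or.inl ⟨j.succ, rfl⟩)
  · rintro _ (⟨i, rfl⟩ | rfl)
    · exact e_mem_span_halfBasis i
    · exact subset_span ⟨0, rfl⟩

theorem exists_basis_weightLatticeB (m : ℕ) :
    ∃ b : Basis (Fin (m + 1)) ℤ (weightLatticeB (m + 1)), ∀ i, (b i : _ → ℝ) = halfBasis m i :=
  exists_basis_of_span_eq ((linearIndependent_halfBasis m).restrict_scalars' ℤ) (span_halfBasis m)

/-- A homomorphism on the weight lattice is determined by its values `ξ i` at the `e i` and a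
choice of half of their sum. -/
theorem card_hom_weightLatticeB {R : Type*} [AddCommGroup R] (ξ : Fin (m + 1) → R) :
    Nat.card {f : weightLatticeB (m + 1) →ₗ[ℤ] R //
      (fun i => f (unitVec (integerLattice_le_weightLatticeB _) i)) = ξ} =
      Nat.card {y : R // 2 • y = ∑ i, ξ i} := by
  obtain ⟨b, hb⟩ := exists_basis_weightLatticeB m
  have hsucc (j : Fin m) :
      unitVec (integerLattice_le_weightLatticeB (m + 1)) j.succ = b j.succ :=
    Subtype.ext (hb j.succ).symm
  have hzero : unitVec (integerLattice_le_weightLatticeB (m + 1)) 0 =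
      2 • b 0 - ∑ j : Fin m, b j.succ := Subtype.ext <| by
    simp only [Submodule.coe_sub, Submodule.coe_smul_of_tower, Submodule.coe_sum, hb]
    exact e_zero_eq m
  refine Nat.card_congr
    ⟨fun f => ⟨f.1 (b 0), ?_⟩, fun y => ⟨b.constr ℤ (Fin.cons y.1 fun j => ξ j.succ), ?_⟩,
      fun f => Subtype.ext (b.ext fun i => ?_), fun y => Subtype.ext ?_⟩
  · obtain ⟨f, rfl⟩ := f
    simp [Fin.sum_univ_succ, hzero, hsucc]
  · obtain ⟨y, hy⟩ := y
    refine funext (Fin.cases ?_ fun j => ?_)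
    · simp only [hzero, map_sub, map_nsmul, map_sum, Basis.constr_basis, Fin.cons_zero,
        Fin.cons_succ, hy, Fin.sum_univ_succ, add_sub_cancel_right]
    · simp only [hsucc, Basis.constr_basis, Fin.cons_succ]
  · obtain ⟨f, rfl⟩ := f
    rw [Basis.constr_basis]
    refine Fin.cases rfl (fun j => ?_) i
    exact congrArg f (hsucc j)
  · simp only [Basis.constr_basis, Fin.cons_zero]

theorem finsum_hom_weightLatticeB {K : Type*} [Field K] [CharZero K] {N : ℕ} [NeZero N]
    (G : (Fin (m + 1) → ZMod (2 * N)) → K) :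
    ∑ᶠ f : weightLatticeB (m + 1) →ₗ[ℤ] ZMod (2 * N),
        G (fun i => f (unitVec (integerLattice_le_weightLatticeB _) i)) =
      ∑ ξ, (1 + parityChar K N (∑ i, ξ i)) * G ξ := by
  obtain ⟨b, -⟩ := exists_basis_weightLatticeB m
  have := finite_hom_zmod b (2 * N)
  refine (finsum_comp_eq_sum_card (fun (f : weightLatticeB (m + 1) →ₗ[ℤ] ZMod (2 * N)) i =>
    f (unitVec (integerLattice_le_weightLatticeB _) i)) G).trans (sum_congr rfl fun ξ _ => ?_)
  rw [card_hom_weightLatticeB, card_two_nsmul_eq]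

theorem coboundary_eq_coeff_halfSeries {A : Finset (Fin (m + 1) → ℝ)}
    (hA : (A : Set (Fin (m + 1) → ℝ)) ⊆ integerLattice (m + 1)) (t : RatXY)
    (hsum : ∀ q, torusSum (weightLatticeB (m + 1)) A varY q =
      ∑ᶠ f : weightLatticeB (m + 1) →ₗ[ℤ] ZMod q,
        (signedWeight varY fun i => f (unitVec (integerLattice_le_weightLatticeB _) i)) *
          ∏ i, if f (unitVec (integerLattice_le_weightLatticeB _) i) = 0 then t else 1) :
    varX ^ (m + 1 - rank A) * coboundary (weightLatticeB (m + 1)) A / (m + 1).factorial =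
      coeff (m + 1) (halfSeries varY t varX) := by
  obtain ⟨b, hb⟩ := exists_basis_weightLatticeB m
  have hcoeff := coboundary_eq_coeff_of_torusSum (b := b) (k := 0) (n := m + 1)
    (isPolynomialFamily_halfSeries varY t)
    (by simpa only [hb] using linearIndependent_halfBasis m)
    (hA.trans (integerLattice_le_weightLatticeB _)) four_ne_zero fun q hq hdvd => by
      obtain ⟨k, rfl⟩ := hdvd
      obtain ⟨j, rfl⟩ := Nat.exists_eq_succ_of_ne_zero (right_ne_zero_of_mul hq)
      rw [show 4 * (j + 1) = 2 * (2 * (j + 1)) by ring, ← sum_signedWeight_eq_halfSeries, pow_zero,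
        one_mul, hsum]
      exact finsum_hom_weightLatticeB fun ξ => signedWeight varY ξ * ∏ i, if ξ i = 0 then t else 1
  rwa [Fintype.card_fin, zero_add] at hcoeff

theorem coeff_zero_halfSeries (t : RatXY) : coeff 0 (halfSeries varY t varX) = 2 := by
  rw [coeff_zero_eq_constantCoeff_apply, constantCoeff_halfSeries]

theorem PsiWB_add_one : PsiWB + 1 = halfSeries varY varY varX := by
  ext n
  rw [map_add, PsiWB, egf, coeff_mk, coeff_one]
  cases n with
  | zero =>
    have hempty : rootsB 0 = ∅ := by simp [rootsB, rootsD_eq_empty]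
    rw [hempty, coboundary_empty, coeff_zero_halfSeries]
    norm_num
  | succ m =>
    have hcoeff := coboundary_eq_coeff_halfSeries (rootsB_subset (m + 1)) varY fun q =>
      torusSum_rootsB varY _
    rw [rank_rootsB, Nat.sub_self, pow_zero, one_mul] at hcoeff
    rw [hcoeff, if_neg m.succ_ne_zero, add_zero]

/-- The series on the right has coefficient `X ^ (n - r(D_n)) * ψ(D_n)` of `Z ^ n / n!`. Since
`D_1` is empty, of rank `0` in a lattice of rank `1`, this explains the term `(X - 1) Z`. -/
theorem PsiWD_add : PsiWD + 1 + C (varX - 1) * X = halfSeries varY 1 varX := by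
  ext n
  rw [map_add, map_add, PsiWD, egf, coeff_mk, coeff_one, coeff_C_mul, coeff_X]
  cases n with
  | zero =>
    rw [rootsD_eq_empty zero_le_one, coboundary_empty, coeff_zero_halfSeries]
    norm_num
  | succ m =>
    have hcoeff := coboundary_eq_coeff_halfSeries (rootsD_subset (m + 1)) 1 fun q => by
      simp only [ite_self, prod_const_one, mul_one]
      exact torusSum_rootsD varY _
    rw [← hcoeff, if_neg m.succ_ne_zero, add_zero]
    obtain rfl | hm := Nat.eq_zero_or_pos m
    · have hrank : rank (∅ : Finset (Fin (0 + 1) → ℝ)) = 0 := by simp [rank]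
      rw [rootsD_eq_empty (zero_add 1).le, hrank, coboundary_empty, coboundary_empty]
      norm_num
    · rw [rank_rootsD (by lia), if_neg (by lia), Nat.sub_self, pow_zero, one_mul, mul_zero,
        add_zero]
      rfl

end HalfLattice

end TypesBCD

section CyclicProducts

open Finset PowerSeries

variable {K : Type*} [Field K]

/-- The product `F(ω⁰Z, Y) ⋯ F(ω^(d-1)Z, Y)` of the theorem, written as a product over all `d`-th
roots of unity so as not to depend on the choice of a primitive one. -/
noncomputable def cyclicProduct (d : ℕ) (Y : K) : PowerSeries K :=
  ∏ z ∈ Polynomial.nthRootsFinset d (1 : K), deformedExp z Y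

theorem constantCoeff_cyclicProduct (d : ℕ) (Y : K) : constantCoeff (cyclicProduct d Y) = 1 := by
  rw [cyclicProduct, map_prod, prod_congr rfl fun z _ => constantCoeff_deformedExp z Y,
    prod_const_one]

theorem cyclicProduct_eq_prod_range {d : ℕ} {ω : K} (hω : IsPrimitiveRoot ω d) (Y : K) :
    cyclicProduct d Y = ∏ k ∈ range d, deformedExp (ω ^ k) Y := by
  classical
  rw [cyclicProduct, Polynomial.nthRootsFinset, ← Multiset.toFinset_eq hω.nthRoots_one_nodup,
    prod_mk, hω.nthRoots_eq (one_pow d), Multiset.map_map, ← range_val, ← prod_eq_multiset_prod]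
  simp only [Function.comp_apply, mul_one]

theorem rescale_deformedExp (a α β : K) :
    rescale a (deformedExp α β) = deformedExp (a * α) β := by
  ext n
  simp only [coeff_rescale, deformedExp, coeff_mk]
  ring

theorem rescale_cyclicProduct {d : ℕ} [NeZero d] {ω : K} (hω : ω ^ d = 1) (Y : K) :
    rescale ω (cyclicProduct d Y) = cyclicProduct d Y := by
  have hd : 0 < d := NeZero.pos d
  have hω0 : ω ≠ 0 := fun h => by simp [h, hd.ne'] at hω
  rw [cyclicProduct, map_prod]
  refine prod_bij' (fun z _ => ω * z) (fun z _ => ω⁻¹ * z) ?_ ?_ ?_ ?_ fun z _ =>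
    rescale_deformedExp ω z Y
  all_goals simp +contextual [Polynomial.mem_nthRootsFinset hd, mul_pow, hω, hω0]

theorem X_pow_dvd_cyclicProduct_sub_one {d : ℕ} [NeZero d] {ω : K} (hω : IsPrimitiveRoot ω d)
    (Y : K) : X ^ d ∣ cyclicProduct d Y - 1 := by
  rw [X_pow_dvd_iff]
  intro k hk
  rw [map_sub, coeff_one]
  split_ifs with hk0
  · rw [hk0, coeff_zero_eq_constantCoeff_apply, constantCoeff_cyclicProduct, sub_self]
  · have hcoeff := congrArg (coeff k) (rescale_cyclicProduct hω.pow_eq_one Y)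
    rw [coeff_rescale] at hcoeff
    rw [sub_zero]
    by_contra h
    exact hω.pow_ne_one_of_pos_of_lt hk0 hk (mul_right_cancel₀ h (hcoeff.trans (one_mul _).symm))

theorem prod_range_mul_of_pow_eq_one {M R : Type*} [CommMonoid M] [Monoid R] {d : ℕ} {η : R}
    (hη : η ^ d = 1) (f : R → M) (k : ℕ) :
    ∏ i ∈ range (d * k), f (η ^ i) = (∏ i ∈ range d, f (η ^ i)) ^ k := by
  induction k with
  | zero => simp
  | succ k ih =>
    rw [Nat.mul_succ, prod_range_add, ih, pow_succ]
    simp_rw [pow_add, pow_mul, hη, one_pow, one_mul]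

variable {q : ℕ} [NeZero q]

theorem isPrimitiveRoot_zmodChar {ζ : K} (hζ : IsPrimitiveRoot ζ q) (c : ZMod q) :
    IsPrimitiveRoot (AddChar.zmodChar q hζ.pow_eq_one c) (addOrderOf c) := by
  refine (IsPrimitiveRoot.iff_def _ _).2 ⟨?_, fun l hl => ?_⟩
  · rw [← AddChar.map_nsmul_eq_pow, addOrderOf_nsmul_eq_zero, AddChar.map_zero_eq_one]
  · rw [← AddChar.map_nsmul_eq_pow, AddChar.zmodChar_apply, hζ.pow_eq_one_iff_dvd] at hl
    rw [addOrderOf_dvd_iff_nsmul_eq_zero, ← ZMod.val_eq_zero]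
    exact Nat.eq_zero_of_dvd_of_lt hl (ZMod.val_lt _)

theorem addOrderOf_zmod_dvd (c : ZMod q) : addOrderOf c ∣ q := by
  simpa only [ZMod.card] using addOrderOf_dvd_card (x := c)

theorem prod_deformedExp_zmodChar {ζ : K} (hζ : IsPrimitiveRoot ζ q) (Y : K) (c : ZMod q) :
    ∏ a, deformedExp (AddChar.zmodChar q hζ.pow_eq_one (c * a)) Y =
      cyclicProduct (addOrderOf c) Y ^ (q / addOrderOf c) := by
  have hη := isPrimitiveRoot_zmodChar hζ c
  have hval (a : ZMod q) : AddChar.zmodChar q hζ.pow_eq_one (c * a) =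
      AddChar.zmodChar q hζ.pow_eq_one c ^ a.val := by
    rw [← AddChar.map_nsmul_eq_pow, nsmul_eq_mul, ZMod.natCast_zmod_val, mul_comm]
  simp_rw [hval]
  rw [cyclicProduct_eq_prod_range hη,
    ← prod_range_mul_of_pow_eq_one hη.pow_eq_one (fun z => deformedExp z Y),
    Nat.mul_div_cancel' (addOrderOf_zmod_dvd c)]
  obtain ⟨m, rfl⟩ := Nat.exists_eq_succ_of_ne_zero (NeZero.ne q)
  exact Fin.prod_univ_eq_prod_range
    (fun k => deformedExp (AddChar.zmodChar (m + 1) hζ.pow_eq_one c ^ k) Y) (m + 1)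

theorem natCast_mul_sum_ite_sum_eq_zero {n : ℕ} {ψ : AddChar (ZMod q) K} (hψ : ψ.IsPrimitive)
    (w : (Fin n → ZMod q) → K) :
    (q : K) * ∑ x, (if ∑ i, x i = 0 then w x else 0) =
      ∑ c, ∑ x, w x * ∏ i, ψ (c * x i) := by
  rw [sum_comm, mul_sum]
  refine sum_congr rfl fun x _ => ?_
  simp_rw [← addChar_sum_eq_prod, ← mul_sum]
  rw [AddChar.sum_mulShift _ hψ]
  split_ifs <;> simp [mul_comm]

theorem sum_comp_addOrderOf {M : Type*} [AddCommMonoid M] (f : ℕ → M) :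
    ∑ c : ZMod q, f (addOrderOf c) = ∑ d ∈ q.divisors, d.totient • f d := by
  rw [← sum_fiberwise_of_maps_to (g := fun c : ZMod q => addOrderOf c) (t := q.divisors)
    fun c _ => Nat.mem_divisors.2 ⟨addOrderOf_zmod_dvd c, NeZero.ne q⟩]
  refine sum_congr rfl fun d hd => ?_
  rw [sum_congr rfl fun c hc => by rw [(mem_filter.1 hc).2], sum_const,
    IsAddCyclic.card_addOrderOf_eq_totient]
  rw [Fintype.card_eq_nat_card, Nat.card_zmod]
  exact Nat.dvd_of_mem_divisors hd

theorem sum_colourings_sum_eq_zero [CharZero K] (n : ℕ) {ζ : K} (hζ : IsPrimitiveRoot ζ q)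
    (Y : K) :
    (q : K) * ∑ x : Fin n → ZMod q, (if ∑ i, x i = 0 then
      ∏ p ∈ pairs n, (if x p.1 = x p.2 then Y else 1) else 0) =
      n.factorial * ∑ d ∈ q.divisors, (d.totient : K) * coeff n (cyclicProduct d Y ^ (q / d)) := by
  rw [natCast_mul_sum_ite_sum_eq_zero (AddChar.zmodChar_primitive_of_primitive_root q hζ),
    sum_congr rfl fun c _ =>
      sum_colourings n (fun _ => Y) fun a => AddChar.zmodChar q hζ.pow_eq_one (c * a)]
  simp_rw [prod_deformedExp_zmodChar hζ, ← nsmul_eq_mul]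
  rw [← smul_sum, sum_comp_addOrderOf fun d => coeff n (cyclicProduct d Y ^ (q / d))]

/-- The truncation `∑_{d ≤ n} φ(d) (cyclicProduct d Y ^ (c / d) - 1)` of the right-hand side of the
formula in type `A` at `X = c`. -/
noncomputable def cyclicSeries [BinomialRing K] (n : ℕ) (Y c : K) : PowerSeries K :=
  ∑ d ∈ Icc 1 n, C (d.totient : K) * (binomialPower (cyclicProduct d Y) (c / d) - 1)

variable [CharZero K] [BinomialRing K]

theorem isPolynomialFamily_cyclicSeries (n : ℕ) (Y : K) :
    IsPolynomialFamily (cyclicSeries n Y) := by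
  refine IsPolynomialFamily.sum _ fun d _ => ?_
  simp_rw [sub_eq_add_neg]
  exact (IsPolynomialFamily.const _).mul
    ((isPolynomialFamily_binomialPower_div (constantCoeff_cyclicProduct d Y) d).add (.const _))

theorem sum_divisors_eq_coeff_cyclicSeries {n : ℕ} (hn : n ≠ 0)
    (hq : n.factorial ∣ q) {ζ : K} (hζ : IsPrimitiveRoot ζ q) (Y : K) :
    ∑ d ∈ q.divisors, (d.totient : K) * coeff n (cyclicProduct d Y ^ (q / d)) =
      coeff n (cyclicSeries n Y q) := by
  have hsub : Icc 1 n ⊆ q.divisors := fun d hd => Nat.mem_divisors.2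
    ⟨(Nat.dvd_factorial (mem_Icc.1 hd).1 (mem_Icc.1 hd).2).trans hq, NeZero.ne q⟩
  have hpow (d : ℕ) (hd : d ∈ q.divisors) : cyclicProduct d Y ^ (q / d) =
      binomialPower (cyclicProduct d Y) ((q : K) / d) := by
    rw [← Nat.cast_div (Nat.dvd_of_mem_divisors hd)
      (Nat.cast_ne_zero.2 (Nat.pos_of_mem_divisors hd).ne'),
      binomialPower_natCast (constantCoeff_cyclicProduct d Y)]
  rw [cyclicSeries, map_sum, ← sum_subset hsub]
  · refine sum_congr rfl fun d hd => ?_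
    rw [hpow d (hsub hd), coeff_C_mul, map_sub, coeff_one, if_neg hn, sub_zero]
  · intro d hd hdn
    obtain ⟨k, rfl⟩ := Nat.dvd_of_mem_divisors hd
    have : NeZero d := ⟨(Nat.pos_of_mem_divisors hd).ne'⟩
    have hroot : IsPrimitiveRoot (ζ ^ k) d := hζ.pow (NeZero.pos _) (mul_comm d k)
    rw [hpow d hd, coeff_binomialPower_of_lt (X_pow_dvd_cyclicProduct_sub_one hroot Y) _
      (by grind), coeff_one, if_neg hn, mul_zero]

theorem sum_colourings_sum_eq_zero_eq_cyclicSeries {n : ℕ} (hn : n ≠ 0)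
    (hq : n.factorial ∣ q) {ζ : K} (hζ : IsPrimitiveRoot ζ q) (Y : K) :
    (q : K) * ∑ x : Fin n → ZMod q, (if ∑ i, x i = 0 then
      ∏ p ∈ pairs n, (if x p.1 = x p.2 then Y else 1) else 0) =
      n.factorial * coeff n (cyclicSeries n Y q) := by
  rw [sum_colourings_sum_eq_zero n hζ, sum_divisors_eq_coeff_cyclicSeries hn hq hζ]

end CyclicProducts

section TypeA

open Finset Submodule Module PowerSeries

theorem sum_eA (n : ℕ) : ∑ i, (eA i : SpaceA n) = 0 :=
  (map_sum (mkQ _) e univ).symm.trans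
    ((Submodule.Quotient.mk_eq_zero _).2 (mem_span_singleton_self (∑ i, e i)))

theorem span_eA_eq_top (n : ℕ) : span ℝ (Set.range (eA : Fin n → SpaceA n)) = ⊤ := by
  have h := congrArg (Submodule.map (span ℝ {(∑ i, e i : Fin n → ℝ)}).mkQ)
    (Pi.basisFun ℝ (Fin n)).span_eq
  rwa [map_span, ← Set.range_comp, Submodule.map_top, range_mkQ, ← e_eq_basisFun] at h

theorem finrank_spaceA (m : ℕ) : finrank ℝ (SpaceA (m + 1)) = m := by
  have hne : (∑ i, e i : Fin (m + 1) → ℝ) ≠ 0 := fun h => by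
    simpa [e_apply] using congrFun h 0
  have h := finrank_quotient_add_finrank (span ℝ {(∑ i, e i : Fin (m + 1) → ℝ)})
  rw [finrank_span_singleton hne, finrank_fin_fun] at h
  exact Nat.add_right_cancel h

theorem eA_mem_span_eA_succ {m : ℕ} {R : Type*} [Ring R] [Module R (SpaceA (m + 1))]
    (i : Fin (m + 1)) :
    eA i ∈ span R (Set.range fun j : Fin m => (eA j.succ : SpaceA (m + 1))) := by
  have hmem (j : Fin m) :
      eA j.succ ∈ span R (Set.range fun j : Fin m => (eA j.succ : SpaceA (m + 1))) :=
    subset_span (Set.mem_range_self j)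
  refine Fin.cases ?_ hmem i
  have h := sum_eA (m + 1)
  rw [Fin.sum_univ_succ] at h
  rw [eq_neg_of_add_eq_zero_left h]
  exact neg_mem (sum_mem fun j _ => hmem j)

theorem linearIndependent_eA_succ (m : ℕ) :
    LinearIndependent ℝ fun j : Fin m => (eA j.succ : SpaceA (m + 1)) := by
  refine linearIndependent_of_top_le_span_of_card_eq_finrank ?_
    (by rw [finrank_spaceA, Fintype.card_fin])
  rw [← span_eA_eq_top, span_le]
  exact Set.range_subset_iff.2 eA_mem_span_eA_succ

theorem exists_basis_weightLatticeA (m : ℕ) :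
    ∃ b : Basis (Fin m) ℤ (weightLatticeA (m + 1)), ∀ j, (b j : SpaceA (m + 1)) = eA j.succ :=
  exists_basis_of_span_eq ((linearIndependent_eA_succ m).restrict_scalars' ℤ) <|
    le_antisymm (span_mono (Set.range_subset_iff.2 fun j => Set.mem_range_self j.succ))
      (span_le.2 (Set.range_subset_iff.2 eA_mem_span_eA_succ))

theorem eA_sub_eA_inj {n : ℕ} {i j k l : Fin n} (h : i < j)
    (he : (eA i - eA j : SpaceA n) = eA k - eA l) : i = k ∧ j = l := by
  obtain ⟨t, ht⟩ := mem_span_singleton.1 ((Submodule.Quotient.eq _).1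
    (show (mkQ _ (e i - e j) : SpaceA n) = mkQ _ (e k - e l) by rwa [map_sub, map_sub]))
  -- Both sides have coordinate sum `0`, whereas that of `t • ∑ i, e i` is `n * t`.
  have hsum : ∑ x, (t • ∑ i, e i : Fin n → ℝ) x = 0 := by
    rw [ht]
    simp [sum_sub_distrib, e_apply]
  have hn : (n : ℝ) ≠ 0 := Nat.cast_ne_zero.2 i.pos.ne'
  have ht0 : t = 0 := by simpa [e_apply, hn] using hsum
  rw [ht0, zero_smul] at ht
  exact e_sub_e_inj h (sub_eq_zero.1 ht.symm)

theorem prod_rootsA {M : Type*} [CommMonoid M] {n : ℕ} (φ : SpaceA n → M) :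
    ∏ v ∈ rootsA n, φ v = ∏ p ∈ pairs n, φ (eA p.1 - eA p.2) := by
  classical
  rw [rootsA, prod_image fun p hp p' _ h => Prod.ext_iff.2 (eA_sub_eA_inj (mem_pairs.1 hp) h)]

/-- The class of `e i`, as an element of the weight lattice of type `A`. -/
def unitVecA {n : ℕ} (i : Fin n) : weightLatticeA n :=
  ⟨eA i, subset_span (Set.mem_range_self i)⟩

theorem rootsA_subset (n : ℕ) : (rootsA n : Set (SpaceA n)) ⊆ weightLatticeA n := by
  classical
  rw [rootsA, coe_image, Set.image_subset_iff]
  exact fun p _ => sub_mem (unitVecA p.1).2 (unitVecA p.2).2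

theorem eA_sub_eA_mem_span_rootsA {n : ℕ} (i j : Fin n) :
    (eA i - eA j : SpaceA n) ∈ span ℝ (rootsA n : Set (SpaceA n)) := by
  classical
  have hlt (i j : Fin n) (h : i < j) :
      (eA i - eA j : SpaceA n) ∈ span ℝ (rootsA n : Set (SpaceA n)) :=
    subset_span (mem_image_of_mem _ (mem_pairs.2 h : (i, j) ∈ pairs n))
  rcases lt_trichotomy i j with h | rfl | h
  · exact hlt i j h
  · exact (sub_self (eA i)).symm ▸ zero_mem _
  · exact neg_sub (eA j) (eA i) ▸ neg_mem (hlt j i h)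

theorem rank_rootsA (m : ℕ) : rank (rootsA (m + 1)) = m := by
  have htop : span ℝ (rootsA (m + 1) : Set (SpaceA (m + 1))) = ⊤ := by
    rw [eq_top_iff, ← span_eA_eq_top, span_le]
    refine Set.range_subset_iff.2 fun i => ?_
    -- `∑ j, (e i - e j) = (m + 1) • e i` in the quotient.
    have hsum := sum_mem (t := univ) fun j _ => eA_sub_eA_mem_span_rootsA i j
    rwa [sum_sub_distrib, sum_eA, sub_zero, sum_const, card_univ, Fintype.card_fin,
      ← Nat.cast_smul_eq_nsmul ℝ, smul_mem_iff _ (Nat.cast_ne_zero.2 m.succ_ne_zero)] at hsum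
  rw [rank, htop, finrank_top, finrank_spaceA]

theorem torusSum_rootsA {K : Type*} [Field K] (n q : ℕ) (Y : K) :
    torusSum (weightLatticeA n) (rootsA n) Y q = ∑ᶠ f : weightLatticeA n →ₗ[ℤ] ZMod q,
      ∏ p ∈ pairs n, if f (unitVecA p.1) = f (unitVecA p.2) then Y else 1 :=
  finsum_congr fun f => by
    classical
    rw [prod_rootsA]
    refine prod_congr rfl fun p _ => if_congr ?_ rfl rfl
    rw [← sub_eq_zero, ← map_sub, ← coe_mem_torusKer]
    rfl

theorem injective_hom_weightLatticeA (m : ℕ) (R : Type*) [AddCommGroup R] :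
    Function.Injective fun (f : weightLatticeA (m + 1) →ₗ[ℤ] R) i => f (unitVecA i) := by
  obtain ⟨b, hb⟩ := exists_basis_weightLatticeA m
  refine fun f g h => b.ext fun j => ?_
  rw [show b j = unitVecA j.succ from Subtype.ext (hb j)]
  exact congrFun h j.succ

theorem range_hom_weightLatticeA (m : ℕ) (R : Type*) [AddCommGroup R] :
    Set.range (fun (f : weightLatticeA (m + 1) →ₗ[ℤ] R) i => f (unitVecA i)) =
      {ξ | ∑ i, ξ i = 0} := by
  have hsum : ∑ i, (unitVecA i : weightLatticeA (m + 1)) = 0 := Subtype.ext <| by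
    rw [Submodule.coe_sum]
    exact sum_eA (m + 1)
  have hsum_map (f : weightLatticeA (m + 1) →ₗ[ℤ] R) : ∑ i, f (unitVecA i) = 0 := by
    rw [← map_sum, hsum, map_zero]
  refine Set.Subset.antisymm (Set.range_subset_iff.2 hsum_map) fun ξ hξ => ?_
  obtain ⟨b, hb⟩ := exists_basis_weightLatticeA m
  let f : weightLatticeA (m + 1) →ₗ[ℤ] R := b.constr ℤ fun j => ξ j.succ
  have hsucc (j : Fin m) : f (unitVecA j.succ) = ξ j.succ := by
    rw [show unitVecA j.succ = b j from Subtype.ext (hb j).symm]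
    exact b.constr_basis ℤ _ j
  refine ⟨f, funext (Fin.cases ?_ hsucc)⟩
  have h := (hsum_map f).trans (show ∑ i, ξ i = 0 from hξ).symm
  simp_rw [Fin.sum_univ_succ, hsucc] at h
  exact add_right_cancel h

theorem finsum_hom_weightLatticeA {K : Type*} [Semiring K] {m q : ℕ} [NeZero q]
    (G : (Fin (m + 1) → ZMod q) → K) :
    ∑ᶠ f : weightLatticeA (m + 1) →ₗ[ℤ] ZMod q, G (fun i => f (unitVecA i)) =
      ∑ ξ, if ∑ i, ξ i = 0 then G ξ else 0 := by
  rw [← finsum_mem_range (injective_hom_weightLatticeA m (ZMod q)), range_hom_weightLatticeA,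
    ← sum_filter]
  exact finsum_mem_eq_sum_of_inter_support_eq _ (by rw [coe_filter_univ])

theorem exists_isPrimitiveRoot_ratXY {n : ℕ} (hn : n ≠ 0) : ∃ ζ : RatXY, IsPrimitiveRoot ζ n :=
  ⟨_, (Complex.isPrimitiveRoot_exp n hn).map_of_injective (algebraMap ℂ RatXY).injective⟩

theorem coboundary_rootsA (m : ℕ) :
    varX * coboundary (weightLatticeA (m + 1)) (rootsA (m + 1)) / (m + 1).factorial =
      coeff (m + 1) (cyclicSeries (m + 1) varY varX) := by
  obtain ⟨b, hb⟩ := exists_basis_weightLatticeA m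
  have hcoeff := coboundary_eq_coeff_of_torusSum (b := b) (k := 1) (n := m + 1)
    (isPolynomialFamily_cyclicSeries (m + 1) varY)
    (by simpa only [hb] using linearIndependent_eA_succ m) (rootsA_subset (m + 1))
    (m + 1).factorial_ne_zero fun q hq hdvd => by
      have : NeZero q := ⟨hq⟩
      obtain ⟨ζ, hζ⟩ := exists_isPrimitiveRoot_ratXY hq
      rw [← sum_colourings_sum_eq_zero_eq_cyclicSeries m.succ_ne_zero hdvd hζ, pow_one,
        torusSum_rootsA]
      exact congrArg _ (finsum_hom_weightLatticeA fun ξ =>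
        ∏ p ∈ pairs (m + 1), if ξ p.1 = ξ p.2 then varY else 1)
  rwa [Fintype.card_fin, rank_rootsA, Nat.sub_self, add_zero, pow_one] at hcoeff

theorem coeff_PsiWA_sub_one (N : ℕ) :
    coeff N (PsiWA - 1) = coeff N (cyclicSeries N varY varX) := by
  rw [map_sub, PsiWA, egf, coeff_mk, coeff_one]
  cases N with
  | zero => simp [cyclicSeries]
  | succ m => rw [if_neg m.succ_ne_zero, if_neg m.succ_ne_zero, sub_zero, coboundary_rootsA]

theorem coeff_cyclicSeries_term_of_lt {N d : ℕ} (h : N < d) :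
    coeff N (C (d.totient : RatXY) *
      (binomialPower (cyclicProduct d varY) (varX / (d : RatXY)) - 1)) = 0 := by
  have : NeZero d := ⟨Nat.ne_zero_of_lt h⟩
  obtain ⟨ζ, hζ⟩ := exists_isPrimitiveRoot_ratXY (NeZero.ne d)
  rw [coeff_C_mul, map_sub,
    coeff_binomialPower_of_lt (X_pow_dvd_cyclicProduct_sub_one hζ varY) _ h, sub_self, mul_zero]

theorem hasFormalSum_cyclicProduct :
    HasFormalSum (fun n : ℕ+ => C ((n : ℕ).totient : RatXY) *
      (binomialPower (cyclicProduct n varY) (varX / ((n : ℕ) : RatXY)) - 1)) (PsiWA - 1) := by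
  intro N
  let a (d : ℕ) : RatXY := coeff N (C (d.totient : RatXY) *
    (binomialPower (cyclicProduct d varY) (varX / (d : RatXY)) - 1))
  have hsupport (d : ℕ) (hd : a d ≠ 0) : d ≤ N := not_lt.1 (mt coeff_cyclicSeries_term_of_lt hd)
  have hfinite : (Function.support a).Finite := (Set.finite_Iic N).subset hsupport
  refine ⟨hfinite.preimage PNat.coe_injective.injOn, ?_⟩
  have hsum : ∑ᶠ d ∈ Set.range ((↑) : ℕ+ → ℕ), a d = ∑ d ∈ Icc 1 N, a d :=
    finsum_mem_eq_sum_of_subset a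
      (fun _ ⟨⟨n, hn⟩, hd⟩ => mem_coe.2 (mem_Icc.2 ⟨hn ▸ n.pos, hsupport _ hd⟩))
      fun d hd => ⟨⟨d, (mem_Icc.1 (mem_coe.1 hd)).1⟩, rfl⟩
  rw [finsum_mem_range PNat.coe_injective] at hsum
  rw [hsum, coeff_PsiWA_sub_one, cyclicSeries, map_sum]

theorem hasFormalSum_typeA (ω : ℕ+ → ℂ) (hω : ∀ n : ℕ+, IsPrimitiveRoot (ω n) n) :
    HasFormalSum
      (fun n : ℕ+ => C ((n : ℕ).totient : RatXY) *
        (power (∏ k ∈ range (n : ℕ), F (algebraMap ℂ RatXY (ω n ^ k)) varY)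
          (varX / ((n : ℕ) : RatXY)) - 1))
      (PsiWA - 1) := by
  convert hasFormalSum_cyclicProduct using 2 with n
  rw [cyclicProduct_eq_prod_range ((hω n).map_of_injective (algebraMap ℂ RatXY).injective)]
  simp only [map_pow]
  rfl

end TypeA

end ArithmeticTutte

open ArithmeticTutte in
theorem theorem1p10 :
    (∀ ω : ℕ+ → ℂ, (∀ n : ℕ+, IsPrimitiveRoot (ω n) n) →
      HasFormalSum
        (fun n : ℕ+ => PowerSeries.C ((n : ℕ).totient : RatXY) *
          (power (∏ k ∈ Finset.range (n : ℕ), F (algebraMap ℂ RatXY (ω n ^ k)) varY)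
            (varX / ((n : ℕ) : RatXY)) - 1))
        (PsiWA - 1)) ∧
    PsiWB + 1 =
      power (F 2 varY) (varX / 4 - 1) * F 1 (varY ^ 2) * F varY (varY ^ 2) *
        (power (F 2 varY) (varX / 4) + power (F (-2) varY) (varX / 4)) ∧
    (PsiWC = power (F 2 varY) (varX / 2 - 1) * F varY (varY ^ 2) ^ 2 ∧ PsiWC = PsiC) ∧
    PsiWD + 1 + PowerSeries.C (varX - 1) * PowerSeries.X =
      power (F 2 varY) (varX / 4 - 1) * F 1 (varY ^ 2) ^ 2 *
        (power (F 2 varY) (varX / 4) + power (F (-2) varY) (varX / 4)) := by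
  refine ⟨hasFormalSum_typeA, PsiWB_add_one, ⟨PsiC_eq, rfl⟩, ?_⟩
  rw [PsiWD_add, halfSeries, sq (F 1 (varY ^ 2)), ← mul_assoc]
  rfl
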